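/- Let $d\ge 1$, let $(\Omega,\mathcal F,\mathbb P)$ be a probability space and let $\tau=(\tau_k)_{k\in\mathbb Z^d}$ be an ergodic action of $\mathbb Z^d$ on it: each $\tau_k$ is measurable and preserves $\mathbb P$, and every invariant event has probability $0$ or $1$. A measurable function $f$ on $\Omega\times\mathbb R^d$ is called stationary if, for every $k\in\mathbb Z^d$, $f(\tau_k\omega,x)=f(\omega,x+k)$ a.s. and a.e. Let $L^p_s$ be the set of stationary functions in $L^p(\Omega,L^p_{\rm loc}(\mathbb R^d))$ and $H^1_s$ the set of stationary functions in $L^2(\Omega,H^1_{\rm loc}(\mathbb R^d))$. A random bounded operator $A$ on $L^2(\mathbb R^d)=L^2(\mathbb R^d,\mathbb C)$ is a map $\omega\mapsto A(\omega)$ into the bounded operators all of whose matrix elements $\langle\varphi,A(\omega)\psi\rangle$ are measurable. It is ergodic if, for every $k\in\mathbb Z^d$, $A(\tau_k\omega)=U_kA(\omega)U_k^*$ a.s., where $(U_kf)(x)=f(x+k)$. It is locally trace class if $\mathbb E\,\mathrm{Tr}\,|\chi A\chi|<\infty$ for every $\chi\in L^\infty_c(\mathbb R^d)$ (bounded functions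 with compact support). An ergodic locally trace class operator $A$ has density $\rho_A$, the unique function in $L^1_s$ such that, for every $\chi\in L^\infty_c(\mathbb R^d)$, $\mathrm{Tr}(\chi A(\omega)\chi)=\int_{\mathbb R^d}\chi^2(x)\rho_A(\omega,x)\,dx$ a.s. It has locally finite kinetic energy if, for each $j=1,\dots,d$, with $P_j=-i\partial_{x_j}$, the operator $P_jAP_j$ is ergodic and locally trace class; that is, there is an ergodic random sesquilinear form $B_j(\omega)$ on the compactly supported functions of $L^2(\mathbb R^d)$ such that a.s. $B_j(\omega)(\varphi,\psi)=\langle P_j\varphi,A(\omega)P_j\psi\rangle$ for all compactly supported $\varphi,\psi\in D(P_j)$, and such that, for every $\chi\in L^\infty_c(\mathbb R^d)$, the form $(\varphi,\psi)\mapsto B_j(\omega)(\overline\chi\varphi,\chi\psi)$ is a.s. that of a random bounded operator $T_\chi(\omega)$ on $L^2(\mathbb R^d)$ with $\mathbb E\,\mathrm{Tr}\,|T_\chi|<\infty$. Theorem (a sufficient condition for representability). Let $\rho\ge 0$ satisfy $\rho\in L^3_s$ and $\sqrt\rho\in H^1_s$. Then there is an ergodic random bounded operator $\gamma$ on $L^2(\mathbb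 R^d)$, self-adjoint a.s., which is locally trace class and has locally finite kinetic energy, such that $0\le\gamma\le 1$ a.s. and $\rho_\gamma=\rho$ a.s. -/

import Mathlib

open MeasureTheory Filter
open scoped ENNReal InnerProductSpace

namespace ErgodicRepr

/-- The configuration space `ℝᵈ`. -/
abbrev Space (d : ℕ) : Type := EuclideanSpace ℝ (Fin d)

/-- The Hilbert space `L²(ℝᵈ, ℂ)`. -/
abbrev L2 (d : ℕ) : Type := Lp ℂ 2 (volume : Measure (Space d))

/-- The space `L^∞(ℝᵈ, ℂ)`. -/
abbrev LInf (d : ℕ) : Type := Lp ℂ ∞ (volume : Measure (Space d))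

/-- A lattice point `k ∈ ℤᵈ` seen as a vector of `ℝᵈ`. -/
noncomputable def latticeVec {d : ℕ} (k : Fin d → ℤ) : Space d :=
  WithLp.toLp 2 (fun i => (k i : ℝ))

/-! ### Stationary functions and the spaces `L^p_s`, `H^1_s` -/

section Functions

variable {Ω : Type*} [MeasurableSpace Ω] {d : ℕ} [AddAction (Fin d → ℤ) Ω]

/-- Measurable functions on `Ω × ℝᵈ` with `f(τ_k ω, x) = f(ω, x + k)` a.s. and a.e.,
for every `k ∈ ℤᵈ`. -/
structure IsStationary (P : Measure Ω) (f : Ω → Space d → ℝ) : Prop where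
  measurable : Measurable (Function.uncurry f)
  stationary : ∀ k : Fin d → ℤ, ∀ᵐ ω ∂P, ∀ᵐ x : Space d, f (k +ᵥ ω) x = f ω (x + latticeVec k)

/-- `f ∈ L^p(Ω, L^p_loc(ℝᵈ))`: `f` is in `L^p(Ω × K)` for every compact set `K`. -/
def MemLpLoc (P : Measure Ω) (p : ℝ≥0∞) (f : Ω → Space d → ℝ) : Prop :=
  ∀ K : Set (Space d), IsCompact K →
    MemLp (Function.uncurry f) p (P.prod (volume.restrict K))

/-- The space `L^p_s`. -/
structure MemLps (P : Measure Ω) (p : ℝ≥0∞) (f : Ω → Space d → ℝ) : Prop where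
  isStationary : IsStationary P f
  memLpLoc : MemLpLoc P p f

end Functions

/-- `g` is the weak derivative `∂f/∂x_j`: `∫ f ∂_jθ = - ∫ g θ` for all `θ ∈ C_c^∞(ℝᵈ)`, where
`f` and `g` are locally integrable. -/
structure HasWeakDeriv {d : ℕ} {F : Type*} [NormedAddCommGroup F] [NormedSpace ℝ F]
    (j : Fin d) (f g : Space d → F) : Prop where
  left : LocallyIntegrable f
  right : LocallyIntegrable g
  integral_eq : ∀ θ : Space d → ℝ, ContDiff ℝ (⊤ : ℕ∞) θ → HasCompactSupport θ →
    ∫ x, (fderiv ℝ θ x (EuclideanSpace.single j (1 : ℝ))) • f x = - ∫ x, θ x • g x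

section Functions

variable {Ω : Type*} [MeasurableSpace Ω] {d : ℕ} [AddAction (Fin d → ℤ) Ω]

/-- The space `H^1_s`: stationary functions in `L²(Ω, H^1_loc(ℝᵈ))`. -/
structure MemH1s (P : Measure Ω) (f : Ω → Space d → ℝ) : Prop where
  memLps : MemLps P 2 f
  exists_grad : ∀ j : Fin d, ∃ g : Ω → Space d → ℝ, Measurable (Function.uncurry g) ∧
    MemLpLoc P 2 g ∧ ∀ᵐ ω ∂P, HasWeakDeriv j (f ω) (g ω)

end Functions

/-! ### Operators on `L²(ℝᵈ)` -/

/-- The unitary operator `U_k f(x) = f(x + k)` on `L²(ℝᵈ)`. -/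
noncomputable def translation {d : ℕ} (k : Fin d → ℤ) : L2 d →L[ℂ] L2 d :=
  (Lp.compMeasurePreservingₗᵢ ℂ (fun x : Space d => x + latticeVec k)
    (measurePreserving_add_right volume (latticeVec k))).toContinuousLinearMap

/-- The operator of multiplication by a function of `L^∞(ℝᵈ)`. -/
noncomputable def mulOp {d : ℕ} (χ : LInf d) : L2 d →L[ℂ] L2 d :=
  (ContinuousLinearMap.mul ℂ ℂ).holderL volume ∞ 2 2 χ

/-- Vanishing a.e. outside some ball. -/
def CompactlySupported {d : ℕ} (f : Space d → ℂ) : Prop :=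
  ∃ R : ℝ, ∀ᵐ x : Space d, R < ‖x‖ → f x = 0

section Trace

variable {H : Type*} [NormedAddCommGroup H] [InnerProductSpace ℂ H] [CompleteSpace H]

theorem exists_onb (H : Type*) [NormedAddCommGroup H] [InnerProductSpace ℂ H] [CompleteSpace H] :
    ∃ w : Set H, Nonempty (HilbertBasis w ℂ H) := by
  obtain ⟨w, b, -⟩ := exists_hilbertBasis ℂ H
  exact ⟨w, ⟨b⟩⟩

/-- A fixed orthonormal basis of a Hilbert space, used to compute traces. -/
noncomputable def onb (H : Type*) [NormedAddCommGroup H] [InnerProductSpace ℂ H]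
    [CompleteSpace H] : HilbertBasis (exists_onb H).choose ℂ H :=
  (exists_onb H).choose_spec.some

/-- The trace norm `Tr |T| ∈ [0, ∞]`, where `|T| = √(T* T)`. -/
noncomputable def traceNorm (T : H →L[ℂ] H) : ℝ≥0∞ :=
  ∑' i, ENNReal.ofReal (RCLike.re ⟪onb H i, (CFC.abs T) (onb H i)⟫_ℂ)

/-- The trace of a (trace class) operator. -/
noncomputable def trace (T : H →L[ℂ] H) : ℂ :=
  ∑' i, ⟪onb H i, T (onb H i)⟫_ℂ

end Trace

section RandomOperators

variable {Ω : Type*} [MeasurableSpace Ω] {d : ℕ}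

/-- A random (bounded) operator: all matrix elements are measurable. -/
def IsRandomOperator (A : Ω → (L2 d →L[ℂ] L2 d)) : Prop :=
  ∀ φ ψ : L2 d, Measurable fun ω => ⟪φ, A ω ψ⟫_ℂ

/-- The space `L¹(Ω, 𝔖₁)`, where `𝔖₁` is the trace class. -/
structure MemL1TraceClass (P : Measure Ω) (T : Ω → (L2 d →L[ℂ] L2 d)) : Prop where
  random : IsRandomOperator T
  lintegral_lt_top : ∫⁻ ω, traceNorm (T ω) ∂P < ∞

/-- A random bounded operator is ergodic if `A(τ_k ω) = U_k A(ω) U_k^*` a.s., for all `k`. -/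
def IsErgodic [AddAction (Fin d → ℤ) Ω] (P : Measure Ω) (A : Ω → (L2 d →L[ℂ] L2 d)) : Prop :=
  ∀ k : Fin d → ℤ, ∀ᵐ ω ∂P,
    A (k +ᵥ ω) = translation k ∘L A ω ∘L ContinuousLinearMap.adjoint (translation k)

/-- The operator `χ A χ`. -/
noncomputable def localize (χ : LInf d) (A : L2 d →L[ℂ] L2 d) : L2 d →L[ℂ] L2 d :=
  mulOp χ ∘L A ∘L mulOp χ

/-- `A` is locally trace class: `χ A χ ∈ L¹(Ω, 𝔖₁)` for all `χ ∈ L^∞_c(ℝᵈ)`. -/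
def IsLocallyTraceClass (P : Measure Ω) (A : Ω → (L2 d →L[ℂ] L2 d)) : Prop :=
  ∀ χ : LInf d, CompactlySupported χ → MemL1TraceClass P fun ω => localize χ (A ω)

/-- `ρ` is the density `ρ_A` of `A`: it is the function of `L^1_s` such that
`Tr (χ A χ) = ∫ χ² ρ` a.s., for all `χ ∈ L^∞_c(ℝᵈ)`. -/
structure IsDensity [AddAction (Fin d → ℤ) Ω] (P : Measure Ω) (A : Ω → (L2 d →L[ℂ] L2 d))
    (ρ : Ω → Space d → ℝ) : Prop where
  memLps : MemLps P 1 ρ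
  trace_eq : ∀ χ : LInf d, CompactlySupported χ →
    ∀ᵐ ω ∂P, trace (localize χ (A ω)) = ∫ x, (χ x) ^ 2 * (ρ ω x : ℂ)

end RandomOperators

/-! ### The operators `P_j A P_j`

`P_j A P_j` is in general not a bounded operator on `L²(ℝᵈ)`; it is given by the form
`(φ, ψ) ↦ ⟨P_j φ, A P_j ψ⟩` on `D(P_j)`. A locally trace class operator acts on compactly
supported `L²` functions, with values in `L²_loc`; such an operator is described
by its sesquilinear form on compactly supported `L²` functions. -/

/-- The subspace `L²_c(ℝᵈ)` of compactly supported functions of `L²(ℝᵈ)`. -/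
noncomputable def L2c (d : ℕ) : Submodule ℂ (L2 d) where
  carrier := {φ | CompactlySupported φ}
  add_mem' := by
    rintro φ ψ ⟨R, hR⟩ ⟨S, hS⟩
    refine ⟨max R S, ?_⟩
    filter_upwards [hR, hS, Lp.coeFn_add φ ψ] with x h1 h2 h3 hx
    rw [h3, Pi.add_apply, h1 (lt_of_le_of_lt (le_max_left _ _) hx),
      h2 (lt_of_le_of_lt (le_max_right _ _) hx), add_zero]
  zero_mem' := by
    refine ⟨0, ?_⟩
    filter_upwards [Lp.coeFn_zero ℂ 2 (volume : Measure (Space d))] with x h1 _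
    rw [h1, Pi.zero_apply]
  smul_mem' := by
    rintro c φ ⟨R, hR⟩
    refine ⟨R, ?_⟩
    filter_upwards [hR, Lp.coeFn_smul c φ] with x h1 h2 hx
    rw [h2, Pi.smul_apply, h1 hx, smul_zero]

theorem mulOp_mem_L2c {d : ℕ} {χ : LInf d} (hχ : CompactlySupported χ) (φ : L2 d) :
    mulOp χ φ ∈ L2c d := by
  obtain ⟨R, hR⟩ := hχ
  refine ⟨R, ?_⟩
  have h := ContinuousLinearMap.coeFn_holder (r := 2) (ContinuousLinearMap.mul ℂ ℂ) χ φ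
  filter_upwards [hR, h] with x h1 h2 hx
  change ((ContinuousLinearMap.mul ℂ ℂ).holder 2 χ φ : L2 d) x = 0
  rw [h2, h1 hx]
  simp

theorem star_compactlySupported {d : ℕ} {χ : LInf d} (hχ : CompactlySupported χ) :
    CompactlySupported (star χ : LInf d) := by
  obtain ⟨R, hR⟩ := hχ
  refine ⟨R, ?_⟩
  filter_upwards [hR, Lp.coeFn_star χ] with x h1 h2 hx
  rw [h2, Pi.star_apply, h1 hx, star_zero]

theorem translation_mem_L2c {d : ℕ} (k : Fin d → ℤ) {φ : L2 d} (hφ : φ ∈ L2c d) :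
    translation k φ ∈ L2c d := by
  obtain ⟨R, hR⟩ := hφ
  refine ⟨R + ‖latticeVec k‖, ?_⟩
  have hmp := measurePreserving_add_right (volume : Measure (Space d)) (latticeVec k)
  have h2 := Lp.coeFn_compMeasurePreserving φ hmp
  filter_upwards [hmp.quasiMeasurePreserving.ae hR, h2] with x h1 h2 hx
  change (Lp.compMeasurePreserving (fun x : Space d => x + latticeVec k) hmp φ : L2 d) x = 0
  rw [h2, Function.comp_apply]
  apply h1
  have := norm_sub_le (x + latticeVec k) (latticeVec k)
  rw [add_sub_cancel_right] at this
  linarith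

/-- Sesquilinear forms on `L²_c(ℝᵈ)`, antilinear in the first variable. -/
abbrev LocalForm (d : ℕ) : Type := L2c d →ₗ⋆[ℂ] L2c d →ₗ[ℂ] ℂ

/-- `φ ∈ D(P_j)` and `η = P_j φ = -i ∂φ/∂x_j`, in `L²(ℝᵈ)`. -/
def IsMomentum {d : ℕ} (j : Fin d) (φ η : L2 d) : Prop :=
  HasWeakDeriv j (φ : Space d → ℂ) (fun x => Complex.I * η x)

section RandomForms

variable {Ω : Type*} [MeasurableSpace Ω] {d : ℕ}

/-- Measurability of all matrix elements. -/
def IsRandomForm (B : Ω → LocalForm d) : Prop :=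
  ∀ φ ψ : L2c d, Measurable fun ω => B ω φ ψ

/-- Ergodicity, `B(τ_k ω) = U_k B(ω) U_k^*` a.s., written as
`⟨U_k φ, B(τ_k ω) U_k ψ⟩ = ⟨φ, B(ω) ψ⟩`. -/
def IsErgodicForm [AddAction (Fin d → ℤ) Ω] (P : Measure Ω) (B : Ω → LocalForm d) : Prop :=
  ∀ k : Fin d → ℤ, ∀ᵐ ω ∂P, ∀ φ ψ : L2c d,
    B (k +ᵥ ω) ⟨translation k φ, translation_mem_L2c k φ.2⟩
      ⟨translation k ψ, translation_mem_L2c k ψ.2⟩ = B ω φ ψ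

/-- The form `χ B χ` on `L²(ℝᵈ)` is, a.s., the form of an operator `T(ω)`, with
`T ∈ L¹(Ω, 𝔖₁)`, for all `χ ∈ L^∞_c(ℝᵈ)`. -/
def IsLocallyTraceClassForm (P : Measure Ω) (B : Ω → LocalForm d) : Prop :=
  ∀ (χ : LInf d) (hχ : CompactlySupported χ), ∃ T : Ω → (L2 d →L[ℂ] L2 d),
    MemL1TraceClass P T ∧
    ∀ᵐ ω ∂P, ∀ φ ψ : L2 d, ⟪φ, T ω ψ⟫_ℂ =
      B ω ⟨mulOp (star χ) φ, mulOp_mem_L2c (star_compactlySupported hχ) φ⟩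
        ⟨mulOp χ ψ, mulOp_mem_L2c hχ ψ⟩

/-- `B` is the operator `P_j A P_j`: a.s., `⟨φ, B(ω) ψ⟩ = ⟨P_j φ, A(ω) P_j ψ⟩` for all compactly
supported `φ, ψ ∈ D(P_j)`. -/
def IsKineticForm (P : Measure Ω) (j : Fin d) (A : Ω → (L2 d →L[ℂ] L2 d))
    (B : Ω → LocalForm d) : Prop :=
  ∀ᵐ ω ∂P, ∀ (φ ψ : L2c d) (η ζ : L2 d), IsMomentum j φ η → IsMomentum j ψ ζ →
    B ω φ ψ = ⟪η, A ω ζ⟫_ℂ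

/-- `A` has locally finite kinetic energy: each `P_j A P_j` is an ergodic locally trace
class operator. -/
def HasLocallyFiniteKineticEnergy [AddAction (Fin d → ℤ) Ω] (P : Measure Ω)
    (A : Ω → (L2 d →L[ℂ] L2 d)) : Prop :=
  ∀ j : Fin d, ∃ B : Ω → LocalForm d,
    IsKineticForm P j A B ∧ IsRandomForm B ∧ IsErgodicForm P B ∧ IsLocallyTraceClassForm P B

end RandomForms

end ErgodicRepr

open MeasureTheory Filter
open scoped ENNReal InnerProductSpace

namespace ErgodicRepr

/-! ### Sums of rank-one operators: trace norm, trace, Bessel families -/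

section Hilbert

variable {H : Type*} [NormedAddCommGroup H] [InnerProductSpace ℂ H] [CompleteSpace H]

/-! Put `u = √ρ`. The operator is an explicit sum `γ = ∑ |v⟩⟨v|` over functions `v = v_{m,n}`,
indexed by `m ∈ ℤ` and `n ∈ ℤᵈ`, which need not be orthogonal. One cuts `u` into levels `u · eta
(log u - m)`, on which `u` is comparable to `exp m`, and cuts each level into cells of side `2 /
L_m` by smooth functions `cellFun m n`. Both partitions are quadratic: their squares sum to one.
Hence `∑ v² = u² = ρ`, which is the density of `γ`.

The bound `γ ≤ 1` is Bessel's inequality for the family `v` (`bessel_orbital`). Write `v = u · w`,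
where `∑ w² = 1`, and let `S` be the set where the cell and the level meet. By Cauchy–Schwarz, `|⟨v,
φ⟩|² ≤ (∫_S u²) ∫ w² |φ|²`. On `S` one has `u² ≤ exp (2m + 2)`, and the volume of a cell is at most
`2 / L_m`, so the choice `L_m ≥ 2 exp (2m + 2)` makes the first factor at most one. Summing over the
family gives `‖φ‖²`.

For the kinetic energy, cutting along a logarithmic scale costs only a multiple of `|∂u|²`, while
cutting into cells costs `L_m² u²`. Since `L_m` is at most a constant times `u² + 1` on its level,
`∑ |∂v|²` is bounded by a multiple of `|∂√ρ|² + ρ³ + ρ` (`exists_tsum_enorm_orbitalDeriv_sq_le`),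
which is locally integrable in expectation because `√ρ ∈ H¹_s` and `ρ ∈ L³_s`. The form of `P_j γ
P_j` is `∑ |∂_j v⟩⟨∂_j v|`.

Each `L_m` is an integer, so a lattice translation permutes the cells of every level and `γ` is
ergodic. The analytic input is the chain rule in `H¹_loc` (`HasWeakDeriv.comp`) and integration by
parts in `H¹` (`inner_weakDeriv_eq_neg`), both obtained by differentiating translations. -/

theorem inner_cfcAbs_cfcAbs (T : H →L[ℂ] H) (x y : H) :
    ⟪CFC.abs T x, CFC.abs T y⟫_ℂ = ⟪T x, T y⟫_ℂ := by
  have hsa : IsSelfAdjoint (CFC.abs T) := IsSelfAdjoint.of_nonneg (CFC.abs_nonneg T)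
  rw [← ContinuousLinearMap.adjoint_inner_right, hsa.adjoint_eq,
    ← ContinuousLinearMap.adjoint_inner_right T]
  have h := congrArg (fun S : H →L[ℂ] H => S y) (CFC.abs_mul_abs T)
  simp only [mul_apply_eq_comp, ContinuousLinearMap.star_eq_adjoint] at h
  rw [h]

theorem norm_cfcAbs_apply (T : H →L[ℂ] H) (x : H) : ‖CFC.abs T x‖ = ‖T x‖ := by
  have h1 := inner_cfcAbs_cfcAbs T x x
  rw [inner_self_eq_norm_sq_to_K, inner_self_eq_norm_sq_to_K] at h1
  have h2 : ‖CFC.abs T x‖ ^ 2 = ‖T x‖ ^ 2 := by exact_mod_cast h1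
  exact (pow_left_inj₀ (norm_nonneg _) (norm_nonneg _) two_ne_zero).1 h2

/-- Polar decomposition, in weak form. -/
theorem exists_polar (T : H →L[ℂ] H) :
    ∃ W : H →L[ℂ] H, (∀ x, ‖W x‖ ≤ ‖x‖) ∧ ∀ x y, ⟪x, CFC.abs T y⟫_ℂ = ⟪W x, T y⟫_ℂ := by
  set S : H →L[ℂ] H := CFC.abs T with hS
  set K : Submodule ℂ H := (LinearMap.range S.toLinearMap).topologicalClosure with hK
  have hmem : ∀ x, S x ∈ K := fun x => Submodule.le_topologicalClosure _ ⟨x, rfl⟩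
  have : CompleteSpace K := (Submodule.isClosed_topologicalClosure _).completeSpace_coe
  let e : H →ₗ[ℂ] K := S.toLinearMap.codRestrict K hmem
  have he : ∀ x, ((e x : K) : H) = S x := fun _ => rfl
  have hd : DenseRange e := by
    intro y
    rw [closure_subtype, ← Set.range_comp]
    exact y.2
  have hn : ∀ x, ‖T.toLinearMap x‖ ≤ 1 * ‖e x‖ := by
    intro x
    rw [one_mul, Submodule.coe_norm, he, hS, norm_cfcAbs_apply]
    rfl
  -- The isometry `|T| x ↦ T x`, extended by continuity to the closure of the range of `|T|`. It is
  -- composed below with the orthogonal projection onto that closure.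
  set W₀ : K →L[ℂ] H := T.toLinearMap.extendOfNorm e with hW₀
  have hW₀e : ∀ x, W₀ (e x) = T x := fun x => LinearMap.extendOfNorm_eq hd ⟨1, hn⟩ x
  have hW₀n : ∀ y, ‖W₀ y‖ ≤ ‖y‖ := fun y => by
    simpa using LinearMap.norm_extendOfNorm_apply_le hd 1 hn y
  have hK' : ∀ (k : K) y, ⟪(k : H), S y⟫_ℂ = ⟪W₀ k, T y⟫_ℂ := by
    intro k y
    refine hd.induction_on (p := fun k : K => ⟪(k : H), S y⟫_ℂ = ⟪W₀ k, T y⟫_ℂ) k ?_ ?_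
    · exact isClosed_eq (by fun_prop) (by fun_prop)
    · intro x
      rw [hW₀e, he, hS, inner_cfcAbs_cfcAbs]
  refine ⟨W₀ ∘L K.orthogonalProjectionOnto, fun x => ?_, fun x y => ?_⟩
  · exact (hW₀n _).trans (K.norm_orthogonalProjectionOnto_apply_le x)
  · rw [ContinuousLinearMap.comp_apply, ← hK']
    rw [← K.inner_orthogonalProjectionOnto_eq_of_mem_right ⟨S y, hmem y⟩ x]
    rfl

theorem tsum_enorm_inner_sq {H ι : Type*} [NormedAddCommGroup H] [InnerProductSpace ℂ H]
    (b : HilbertBasis ι ℂ H) (x : H) :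
    ∑' i, ‖⟪b i, x⟫_ℂ‖ₑ ^ 2 = ‖x‖ₑ ^ 2 := by
  have h := b.hasSum_inner_mul_inner x x
  have h2 : HasSum (fun i => ‖⟪b i, x⟫_ℂ‖ ^ 2) (‖x‖ ^ 2) := by
    rw [← RCLike.hasSum_ofReal (𝕜 := ℂ)]
    convert h using 1
    · ext i
      rw [← inner_conj_symm x (b i), RCLike.conj_mul]
      simp
    · rw [inner_self_eq_norm_sq_to_K]
      simp
  have h3 := ENNReal.ofReal_tsum_of_nonneg (fun i => sq_nonneg ‖⟪b i, x⟫_ℂ‖) h2.summable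
  rw [h2.tsum_eq] at h3
  simp only [ENNReal.ofReal_pow (norm_nonneg _), ofReal_norm] at h3
  exact h3.symm

theorem enorm_mul_le_add_sq (x y : ℂ) : ‖x * y‖ₑ ≤ ‖x‖ₑ ^ 2 + ‖y‖ₑ ^ 2 := by
  rw [enorm_mul]
  rcases le_total ‖x‖ₑ ‖y‖ₑ with h | h
  · calc ‖x‖ₑ * ‖y‖ₑ ≤ ‖y‖ₑ * ‖y‖ₑ := by gcongr
      _ = ‖y‖ₑ ^ 2 := (sq _).symm
      _ ≤ _ := le_add_self
  · calc ‖x‖ₑ * ‖y‖ₑ ≤ ‖x‖ₑ * ‖x‖ₑ := by gcongr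
      _ = ‖x‖ₑ ^ 2 := (sq _).symm
      _ ≤ _ := le_self_add

theorem tsum_enorm_inner_mul_inner_le {H ι : Type*} [NormedAddCommGroup H]
    [InnerProductSpace ℂ H] (b : HilbertBasis ι ℂ H) (x y : H) :
    ∑' i, ‖⟪b i, x⟫_ℂ * ⟪y, b i⟫_ℂ‖ₑ ≤ ‖x‖ₑ ^ 2 + ‖y‖ₑ ^ 2 := by
  calc ∑' i, ‖⟪b i, x⟫_ℂ * ⟪y, b i⟫_ℂ‖ₑ
      ≤ ∑' i, (‖⟪b i, x⟫_ℂ‖ₑ ^ 2 + ‖⟪b i, y⟫_ℂ‖ₑ ^ 2) := by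
        refine ENNReal.tsum_le_tsum fun i => (enorm_mul_le_add_sq _ _).trans_eq ?_
        rw [← inner_conj_symm y (b i), RCLike.enorm_conj]
    _ = _ := by rw [ENNReal.tsum_add, tsum_enorm_inner_sq, tsum_enorm_inner_sq]

theorem summable_of_tsum_enorm_lt_top {ι : Type*} {f : ι → ℂ} (h : ∑' i, ‖f i‖ₑ < ∞) :
    Summable f := by
  refine Summable.of_norm ?_
  have := ENNReal.summable_toReal h.ne
  simpa using this

theorem summable_norm_of_tsum_enorm_lt_top {ι : Type*} {f : ι → ℂ} (h : ∑' i, ‖f i‖ₑ < ∞) :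
    Summable fun i => ‖f i‖ := by
  have := ENNReal.summable_toReal h.ne
  simpa using this

variable {A : Type*} {T : H →L[ℂ] H} {a b : A → H}

/-- The polar decomposition writes `Tr |T|` as a double sum of `⟨e_i, W* a_α⟩ ⟨b_α, e_i⟩`, with `W`
a contraction. After the sums are exchanged, `|xy| ≤ |x|² + |y|²` and Parseval in `i` bound it. -/
theorem traceNorm_le_of_hasSum
    (hT : ∀ φ ψ, HasSum (fun α => ⟪φ, a α⟫_ℂ * ⟪b α, ψ⟫_ℂ) ⟪φ, T ψ⟫_ℂ) :
    traceNorm T ≤ ∑' α, (‖a α‖ₑ ^ 2 + ‖b α‖ₑ ^ 2) := by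
  obtain ⟨W, hW, hWT⟩ := exists_polar T
  have hW' : ∀ x, ‖ContinuousLinearMap.adjoint W x‖ ≤ ‖x‖ := by
    have h1 : ‖W‖ ≤ 1 := W.opNorm_le_bound zero_le_one fun x => by simpa using hW x
    intro x
    refine (ContinuousLinearMap.le_opNorm _ x).trans ?_
    rw [LinearIsometryEquiv.norm_map]
    exact mul_le_of_le_one_left (norm_nonneg _) h1
  calc traceNorm T
      ≤ ∑' i, ∑' α, ‖⟪onb H i, ContinuousLinearMap.adjoint W (a α)⟫_ℂ * ⟪b α, onb H i⟫_ℂ‖ₑ := by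
        refine ENNReal.tsum_le_tsum fun i => ?_
        rw [hWT, ← (hT (W (onb H i)) (onb H i)).tsum_eq]
        refine (ENNReal.ofReal_le_ofReal (RCLike.re_le_norm _)).trans ?_
        rw [ofReal_norm]
        refine enorm_tsum_le_tsum_enorm.trans_eq ?_
        simp_rw [ContinuousLinearMap.adjoint_inner_right]
    _ = ∑' α, ∑' i, ‖⟪onb H i, ContinuousLinearMap.adjoint W (a α)⟫_ℂ * ⟪b α, onb H i⟫_ℂ‖ₑ :=
        ENNReal.tsum_comm
    _ ≤ _ := by
        refine ENNReal.tsum_le_tsum fun α => (tsum_enorm_inner_mul_inner_le _ _ _).trans ?_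
        gcongr
        rw [enorm_le_iff_norm_le]
        exact hW' _

/-- The double family over `α` and the basis is absolutely summable, so the sums commute, and
Parseval evaluates the sum over the basis. -/
theorem hasSum_inner_of_hasSum {H ι A : Type*} [NormedAddCommGroup H] [InnerProductSpace ℂ H]
    {T : H →L[ℂ] H} {a b : A → H} (e : HilbertBasis ι ℂ H)
    (hab : ∑' α, (‖a α‖ₑ ^ 2 + ‖b α‖ₑ ^ 2) < ∞)
    (hT : ∀ φ ψ, HasSum (fun α => ⟪φ, a α⟫_ℂ * ⟪b α, ψ⟫_ℂ) ⟪φ, T ψ⟫_ℂ) :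
    HasSum (fun α => ⟪b α, a α⟫_ℂ) (∑' i, ⟪e i, T (e i)⟫_ℂ) := by
  set F : A × ι → ℂ := fun p => ⟪e p.2, a p.1⟫_ℂ * ⟪b p.1, e p.2⟫_ℂ with hF
  have hs : Summable F := by
    refine summable_of_tsum_enorm_lt_top (lt_of_le_of_lt ?_ hab)
    rw [ENNReal.tsum_prod']
    simp only [hF]
    exact ENNReal.tsum_le_tsum fun α => tsum_enorm_inner_mul_inner_le e (a α) (b α)
  have h1 : ∑' i, ⟪e i, T (e i)⟫_ℂ = ∑' p, F p := by
    have h2 : ∑' i, ⟪e i, T (e i)⟫_ℂ = ∑' i, ∑' α, F (α, i) :=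
      tsum_congr fun i => (hT _ _).tsum_eq.symm
    have h3 : Summable (Function.uncurry fun α i => F (α, i)) := hs
    rw [h2, hs.tsum_prod, h3.tsum_comm]
  rw [h1]
  refine hs.hasSum.prod_fiberwise (g := fun α => ⟪b α, a α⟫_ℂ) fun α => ?_
  simpa only [hF, mul_comm] using e.hasSum_inner_mul_inner (b α) (a α)

theorem hasSum_trace_of_hasSum (hab : ∑' α, (‖a α‖ₑ ^ 2 + ‖b α‖ₑ ^ 2) < ∞)
    (hT : ∀ φ ψ, HasSum (fun α => ⟪φ, a α⟫_ℂ * ⟪b α, ψ⟫_ℂ) ⟪φ, T ψ⟫_ℂ) :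
    HasSum (fun α => ⟪b α, a α⟫_ℂ) (trace T) :=
  hasSum_inner_of_hasSum (onb H) hab hT

/-- The rank-one operators have norms `‖a α‖ ‖b α‖`, so their series converges absolutely in
operator norm. This produces the localized operators of the kinetic form. -/
theorem exists_hasSum_of_tsum_lt_top (hab : ∑' α, (‖a α‖ₑ ^ 2 + ‖b α‖ₑ ^ 2) < ∞) :
    ∃ T : H →L[ℂ] H, ∀ φ ψ, HasSum (fun α => ⟪φ, a α⟫_ℂ * ⟪b α, ψ⟫_ℂ) ⟪φ, T ψ⟫_ℂ := by
  have hs : Summable fun α => InnerProductSpace.rankOne ℂ (a α) (b α) := by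
    refine Summable.of_norm ?_
    have h : ∑' α, ‖((‖a α‖ * ‖b α‖ : ℝ) : ℂ)‖ₑ < ∞ := by
      refine lt_of_le_of_lt (ENNReal.tsum_le_tsum fun α => ?_) hab
      push_cast
      refine (enorm_mul_le_add_sq _ _).trans_eq ?_
      congr 2 <;> simp [enorm_eq_nnnorm]
    simpa [abs_of_nonneg] using summable_norm_of_tsum_enorm_lt_top h
  refine ⟨∑' α, InnerProductSpace.rankOne ℂ (a α) (b α), fun φ ψ => ?_⟩
  have h1 := (hs.hasSum.mapL (ContinuousLinearMap.apply ℂ H ψ)).mapL (innerSL ℂ φ)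
  simpa [inner_smul_right, mul_comm] using h1

/-- A Bessel family defines an operator between `0` and `1`. -/
theorem exists_hasSum_of_bessel {v : A → H} (hv : ∀ φ, ∑' α, ‖⟪v α, φ⟫_ℂ‖ₑ ^ 2 ≤ ‖φ‖ₑ ^ 2) :
    ∃ G : H →L[ℂ] H, 0 ≤ G ∧ G ≤ 1 ∧
      ∀ φ ψ, HasSum (fun α => ⟪φ, v α⟫_ℂ * ⟪v α, ψ⟫_ℂ) ⟪φ, G ψ⟫_ℂ := by
  have hlt : ∀ φ, ∑' α, ‖⟪v α, φ⟫_ℂ‖ₑ ^ 2 < ∞ := fun φ =>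
    (hv φ).trans_lt (ENNReal.pow_lt_top enorm_lt_top)
  have hmem : ∀ φ, Memℓp (fun α => ⟪v α, φ⟫_ℂ) 2 := by
    intro φ
    refine memℓp_gen ?_
    have := ENNReal.summable_toReal (hlt φ).ne
    simpa using this
  have hsq : ∀ f : lp (fun _ : A => ℂ) 2, ‖f‖ ^ 2 = ∑' α, ‖f α‖ ^ 2 := fun f => by
    have := lp.norm_rpow_eq_tsum (p := 2) (by norm_num) f
    simpa using this
  -- The analysis operator `φ ↦ (⟨v_α, φ⟩)_α` into `ℓ²`. Bessel's inequality says that it is a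
  -- contraction, hence `0 ≤ V* V ≤ 1`.
  let V₀ : H →ₗ[ℂ] lp (fun _ : A => ℂ) 2 :=
    { toFun := fun φ => ⟨fun α => ⟪v α, φ⟫_ℂ, hmem φ⟩
      map_add' := fun φ ψ => by ext α; exact inner_add_right _ _ _
      map_smul' := fun c φ => by ext α; exact inner_smul_right _ _ _ }
  have hV₀ : ∀ φ, ‖V₀ φ‖ ≤ 1 * ‖φ‖ := by
    intro φ
    rw [one_mul]
    refine (pow_le_pow_iff_left₀ (norm_nonneg _) (norm_nonneg _) two_ne_zero).1 ?_
    rw [hsq]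
    have h1 := ENNReal.toReal_mono (ENNReal.pow_lt_top enorm_lt_top).ne (hv φ)
    rw [ENNReal.tsum_toReal_eq fun α => (ENNReal.pow_lt_top enorm_lt_top).ne] at h1
    simp only [ENNReal.toReal_pow, toReal_enorm] at h1
    exact h1
  let V := V₀.mkContinuous 1 hV₀
  have hVn : ∀ φ, ‖V φ‖ ≤ ‖φ‖ := fun φ => (hV₀ φ).trans_eq (one_mul _)
  refine ⟨ContinuousLinearMap.adjoint V ∘L V, ?_, ?_, fun φ ψ => ?_⟩
  · rw [ContinuousLinearMap.nonneg_iff_isPositive]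
    exact ContinuousLinearMap.isPositive_adjoint_comp_self V
  · rw [ContinuousLinearMap.le_def, ContinuousLinearMap.isPositive_iff_complex]
    intro φ
    have h1 : ⟪((1 : H →L[ℂ] H) - ContinuousLinearMap.adjoint V ∘L V) φ, φ⟫_ℂ
        = ((‖φ‖ ^ 2 - ‖V φ‖ ^ 2 : ℝ) : ℂ) := by
      simp only [sub_apply, one_apply_eq_self, inner_sub_left,
        ContinuousLinearMap.comp_apply, ContinuousLinearMap.adjoint_inner_left,
        inner_self_eq_norm_sq_to_K]
      push_cast
      simp
    rw [h1]
    refine ⟨by rw [RCLike.re_to_complex, Complex.ofReal_re], ?_⟩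
    have := pow_le_pow_left₀ (norm_nonneg _) (hVn φ) 2
    simp only [RCLike.re_to_complex, Complex.ofReal_re]
    linarith
  · rw [ContinuousLinearMap.comp_apply, ContinuousLinearMap.adjoint_inner_right]
    have := lp.hasSum_inner (𝕜 := ℂ) (V φ) (V ψ)
    refine this.congr_fun fun α => ?_
    change _ = ⟪⟪v α, φ⟫_ℂ, ⟪v α, ψ⟫_ℂ⟫_ℂ
    rw [RCLike.inner_apply, inner_conj_symm, mul_comm]

end Hilbert

/-! ### Weak derivatives as generators of translations -/

section WeakDerivatives

variable {d : ℕ} {j : Fin d}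

/-- The vectors of the canonical basis of `ℝᵈ`. -/
noncomputable abbrev basisVec (j : Fin d) : Space d := EuclideanSpace.single j (1 : ℝ)

theorem HasWeakDeriv.congr {F : Type*} [NormedAddCommGroup F] [NormedSpace ℝ F]
    {f g f' g' : Space d → F} (h : HasWeakDeriv j f g) (hf : f =ᵐ[volume] f')
    (hg : g =ᵐ[volume] g') : HasWeakDeriv j f' g' where
  left := h.left.congr hf
  right := h.right.congr hg
  integral_eq θ hθ hθc := by
    have h1 := h.integral_eq θ hθ hθc
    rw [integral_congr_ae (g := fun x => (fderiv ℝ θ x (basisVec j)) • f' x)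
      (hf.mono fun x hx => by simp only [hx])] at h1
    rw [h1, integral_congr_ae (g := fun x => θ x • g' x) (hg.mono fun x hx => by simp only [hx])]

/-- This is what makes the gradient of `√ρ` stationary, a property that `MemH1s` does not include.
-/
theorem HasWeakDeriv.unique {F : Type*} [NormedAddCommGroup F] [NormedSpace ℝ F] [CompleteSpace F]
    {f g g' : Space d → F} (h : HasWeakDeriv j f g) (h' : HasWeakDeriv j f g') :
    g =ᵐ[volume] g' := by
  refine ae_eq_of_integral_contDiff_smul_eq h.right h'.right fun θ hθ hθc => ?_
  have h1 := h.integral_eq θ hθ hθc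
  rw [h'.integral_eq θ hθ hθc] at h1
  exact (neg_injective h1).symm

theorem LocallyIntegrable.comp_add_right {F : Type*} [NormedAddCommGroup F]
    {f : Space d → F} (hf : LocallyIntegrable f) (a : Space d) :
    LocallyIntegrable fun x => f (x + a) := by
  rw [locallyIntegrable_iff] at hf ⊢
  intro K hK
  have h := (measurePreserving_add_right (volume : Measure (Space d)) a)
  have h2 := (h.restrict_preimage_emb (measurableEmbedding_addRight a)
    ((fun x => x + a) '' K)).integrable_comp_emb (measurableEmbedding_addRight a) (g := f)
  rw [Set.preimage_image_eq _ (add_left_injective a)] at h2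
  exact h2.2 (hf _ (hK.image (by fun_prop)))

theorem HasWeakDeriv.comp_add_right {F : Type*} [NormedAddCommGroup F] [NormedSpace ℝ F]
    {f g : Space d → F} (h : HasWeakDeriv j f g) (a : Space d) :
    HasWeakDeriv j (fun x => f (x + a)) (fun x => g (x + a)) where
  left := LocallyIntegrable.comp_add_right h.left a
  right := LocallyIntegrable.comp_add_right h.right a
  integral_eq θ hθ hθc := by
    have h1 := h.integral_eq (fun x => θ (x - a)) (hθ.comp (contDiff_id.sub contDiff_const))
      (hθc.comp_homeomorph (Homeomorph.subRight a))
    simp only [fderiv_comp_sub] at h1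
    rw [← integral_add_right_eq_self _ a, ← integral_add_right_eq_self (fun x => θ (x - a) • g x) a]
      at h1
    simpa only [add_sub_cancel_right] using h1

theorem HasWeakDeriv.ofReal {f g : Space d → ℝ} (h : HasWeakDeriv j f g) :
    HasWeakDeriv j (fun x => (f x : ℂ)) (fun x => (g x : ℂ)) where
  left := fun x => (h.left x).imp fun s hs => ⟨hs.1, hs.2.ofReal⟩
  right := fun x => (h.right x).imp fun s hs => ⟨hs.1, hs.2.ofReal⟩
  integral_eq θ hθ hθc := by
    have h1 := congrArg (fun r : ℝ => (r : ℂ)) (h.integral_eq θ hθ hθc)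
    simp only [Complex.ofReal_neg, ← integral_complex_ofReal] at h1
    simpa using h1

/-- Leibniz rule for the product with a smooth function. -/
theorem HasWeakDeriv.smul {F : Type*} [NormedAddCommGroup F] [NormedSpace ℝ F]
    {f g : Space d → F} (h : HasWeakDeriv j f g) {θ : Space d → ℝ}
    (hθ : ContDiff ℝ (⊤ : ℕ∞) θ) :
    HasWeakDeriv j (fun x => θ x • f x)
      (fun x => θ x • g x + (fderiv ℝ θ x (basisVec j)) • f x) := by
  have hcθ' : Continuous fun x => fderiv ℝ θ x (basisVec j) :=
    (hθ.continuous_fderiv (by simp)).clm_apply continuous_const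
  refine ⟨h.left.continuous_smul hθ.continuous,
    (h.right.continuous_smul hθ.continuous).add (h.left.continuous_smul hcθ'), fun ϕ hϕ hϕc => ?_⟩
  have hcϕ' : Continuous fun x => fderiv ℝ ϕ x (basisVec j) :=
    (hϕ.continuous_fderiv (by simp)).clm_apply continuous_const
  have hϕc' : HasCompactSupport fun x => fderiv ℝ ϕ x (basisVec j) :=
    hϕc.fderiv_apply (𝕜 := ℝ) _
  have h1 := h.integral_eq (fun x => ϕ x * θ x) (hϕ.mul hθ) hϕc.mul_right
  have i1 : Integrable fun x => (fderiv ℝ ϕ x (basisVec j)) • θ x • f x :=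
    (h.left.continuous_smul hθ.continuous).integrable_smul_left_of_hasCompactSupport hcϕ' hϕc'
  have i2 : Integrable fun x => ϕ x • (fderiv ℝ θ x (basisVec j)) • f x :=
    (h.left.continuous_smul hcθ').integrable_smul_left_of_hasCompactSupport hϕ.continuous hϕc
  have i3 : Integrable fun x => ϕ x • θ x • g x :=
    (h.right.continuous_smul hθ.continuous).integrable_smul_left_of_hasCompactSupport
      hϕ.continuous hϕc
  have h2 : ∀ x, fderiv ℝ (fun x => ϕ x * θ x) x (basisVec j) • f x
      = (fderiv ℝ ϕ x (basisVec j)) • θ x • f x + ϕ x • (fderiv ℝ θ x (basisVec j)) • f x := by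
    intro x
    rw [fderiv_fun_mul (hϕ.differentiable (by simp) x) (hθ.differentiable (by simp) x)]
    simp only [add_apply, smul_apply, smul_eq_mul, add_smul, smul_smul]
    rw [add_comm, mul_comm (θ x)]
  simp only [h2] at h1
  rw [integral_add i1 i2] at h1
  simp only [smul_add]
  rw [integral_add i3 i2]
  simp only [mul_smul] at h1
  rw [eq_sub_of_add_eq h1]
  abel

theorem HasWeakDeriv.integral_eq_complex {f g : Space d → ℂ} (h : HasWeakDeriv j f g)
    {θ : Space d → ℂ} (hθ : ContDiff ℝ (⊤ : ℕ∞) θ) (hθc : HasCompactSupport θ) :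
    ∫ x, (fderiv ℝ θ x (basisVec j)) * f x = - ∫ x, θ x * g x := by
  have hre : ContDiff ℝ (⊤ : ℕ∞) fun x => (θ x).re := Complex.reCLM.contDiff.comp hθ
  have him : ContDiff ℝ (⊤ : ℕ∞) fun x => (θ x).im := Complex.imCLM.contDiff.comp hθ
  have hrec : HasCompactSupport fun x => (θ x).re := hθc.comp_left (g := Complex.re) rfl
  have himc : HasCompactSupport fun x => (θ x).im := hθc.comp_left (g := Complex.im) rfl
  have hd := hθ.differentiable (by simp)
  have hfre : ∀ x, fderiv ℝ (fun x => (θ x).re) x (basisVec j)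
      = (fderiv ℝ θ x (basisVec j)).re := fun x => by
    have := (Complex.reCLM.hasFDerivAt.comp x (hd x).hasFDerivAt).fderiv
    exact congrArg (fun L : Space d →L[ℝ] ℝ => L (basisVec j)) this
  have hfim : ∀ x, fderiv ℝ (fun x => (θ x).im) x (basisVec j)
      = (fderiv ℝ θ x (basisVec j)).im := fun x => by
    have := (Complex.imCLM.hasFDerivAt.comp x (hd x).hasFDerivAt).fderiv
    exact congrArg (fun L : Space d →L[ℝ] ℝ => L (basisVec j)) this
  have h1 := h.integral_eq _ hre hrec
  have h2 := h.integral_eq _ him himc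
  have c1 : ∀ {ϕ : Space d → ℝ}, ContDiff ℝ (⊤ : ℕ∞) ϕ → HasCompactSupport ϕ →
      Integrable fun x => fderiv ℝ ϕ x (basisVec j) • f x := fun hϕ hϕc =>
    h.left.integrable_smul_left_of_hasCompactSupport
      ((hϕ.continuous_fderiv (by simp)).clm_apply continuous_const) (hϕc.fderiv_apply (𝕜 := ℝ) _)
  have c2 : ∀ {ϕ : Space d → ℝ}, ContDiff ℝ (⊤ : ℕ∞) ϕ → HasCompactSupport ϕ →
      Integrable fun x => ϕ x • g x := fun hϕ hϕc =>
    h.right.integrable_smul_left_of_hasCompactSupport hϕ.continuous hϕc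
  have e1 : ∀ x, fderiv ℝ θ x (basisVec j) * f x
      = fderiv ℝ (fun x => (θ x).re) x (basisVec j) • f x
        + Complex.I * (fderiv ℝ (fun x => (θ x).im) x (basisVec j) • f x) := fun x => by
    rw [hfre, hfim]
    conv_lhs => rw [← Complex.re_add_im (fderiv ℝ θ x (basisVec j))]
    simp only [Complex.real_smul]
    ring
  have e2 : ∀ x, θ x * g x = (θ x).re • g x + Complex.I * ((θ x).im • g x) := fun x => by
    conv_lhs => rw [← Complex.re_add_im (θ x)]
    simp only [Complex.real_smul]
    ring
  simp only [e1, e2]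
  rw [integral_add (c1 hre hrec) ((c1 him himc).const_mul _), integral_const_mul, h1, h2,
    integral_add (c2 hre hrec) ((c2 him himc).const_mul _), integral_const_mul]
  ring

/-- The translation `f ↦ f(· + a)` on `L²(ℝᵈ)`. -/
noncomputable def shift (a : Space d) : L2 d →ₗᵢ[ℂ] L2 d :=
  Lp.compMeasurePreservingₗᵢ ℂ (fun x : Space d => x + a) (measurePreserving_add_right volume a)

theorem coeFn_shift (a : Space d) (φ : L2 d) : shift a φ =ᵐ[volume] fun x => φ (x + a) :=
  Lp.coeFn_compMeasurePreserving φ (measurePreserving_add_right volume a)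

theorem ae_comp_add_right {p : Space d → Prop} (h : ∀ᵐ x, p x) (a : Space d) :
    ∀ᵐ x, p (x + a) :=
  (measurePreserving_add_right (volume : Measure (Space d)) a).quasiMeasurePreserving.ae h

theorem shift_shift (a b : Space d) (φ : L2 d) : shift a (shift b φ) = shift (a + b) φ := by
  refine Lp.ext ?_
  filter_upwards [coeFn_shift a (shift b φ), coeFn_shift (a + b) φ,
    ae_comp_add_right (coeFn_shift b φ) a] with x h1 h2 h3
  rw [h1, h2, h3, add_assoc]

theorem shift_zero (φ : L2 d) : shift 0 φ = φ := by
  refine Lp.ext ?_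
  filter_upwards [coeFn_shift 0 φ] with x h1
  rw [h1, add_zero]

theorem inner_shift_right (a : Space d) (φ ψ : L2 d) :
    ⟪ψ, shift a φ⟫_ℂ = ⟪shift (-a) ψ, φ⟫_ℂ := by
  rw [← (shift (-a)).inner_map_map, shift_shift, neg_add_cancel, shift_zero]

theorem inner_eq_integral_of_ae_eq {w φ : L2 d} {θ f : Space d → ℂ} (hw : w =ᵐ[volume] θ)
    (hφ : φ =ᵐ[volume] f) : ⟪w, φ⟫_ℂ = ∫ x, (starRingEnd ℂ) (θ x) * f x := by
  rw [L2.inner_def]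
  refine integral_congr_ae ?_
  filter_upwards [hw, hφ] with x h1 h2
  rw [h1, h2, RCLike.inner_apply, mul_comm]

/-- The integral is the convolution of `f` with the reflection of `θ`, evaluated at `s • e`, and
such a convolution is differentiable. -/
theorem hasDerivAt_integral_comp_sub {f : Space d → ℂ} (hf : LocallyIntegrable f)
    {θ : Space d → ℂ} (hθ : ContDiff ℝ (⊤ : ℕ∞) θ) (hθc : HasCompactSupport θ) (e : Space d)
    (s : ℝ) :
    HasDerivAt (fun s : ℝ => ∫ x, θ (x - s • e) * f x)
      (- ∫ x, fderiv ℝ θ (x - s • e) e * f x) s := by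
  set g : Space d → ℂ := fun y => θ (-y) with hg
  have hgs : ContDiff ℝ (⊤ : ℕ∞) g := hθ.comp contDiff_neg
  have hgc : HasCompactSupport g := hθc.comp_homeomorph (Homeomorph.neg _)
  have h1 := hgc.hasFDerivAt_convolution_right (ContinuousLinearMap.mul ℝ ℂ) (μ := volume) hf
    (hgs.of_le (by simp)) (s • e)
  have h2 : HasDerivAt (fun s : ℝ => s • e) e s := by
    simpa using (hasDerivAt_id s).smul_const e
  have h3 := h1.comp_hasDerivAt s h2
  rw [convolution_precompR_apply _ hf (hgc.fderiv ℝ) (hgs.continuous_fderiv (by simp))] at h3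
  have h4 : (fun s : ℝ => ∫ x, θ (x - s • e) * f x)
      = convolution f g (ContinuousLinearMap.mul ℝ ℂ) volume ∘ fun s : ℝ => s • e := by
    ext s
    simp only [Function.comp_apply, convolution, ContinuousLinearMap.mul_apply', hg, neg_sub]
    exact integral_congr_ae (.of_forall fun x => mul_comm _ _)
  rw [h4]
  refine h3.congr_deriv ?_
  · simp only [convolution, ContinuousLinearMap.mul_apply', hg]
    rw [← integral_neg]
    refine (integral_congr_ae (.of_forall fun x => ?_)).symm
    have : fderiv ℝ (fun y => θ (-y)) (s • e - x) = - fderiv ℝ θ (x - s • e) := by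
      have hd : HasFDerivAt θ (fderiv ℝ θ (x - s • e)) (-(s • e - x)) := by
        rw [neg_sub]
        exact (hθ.differentiable (by simp) _).hasFDerivAt
      refine (hd.comp (s • e - x) (hasFDerivAt_id (s • e - x)).neg).fderiv.trans ?_
      ext v
      simp
    simp only [this, neg_apply]
    ring

/-- A change of variables moves the translation onto the smooth function, where it can be
differentiated. The definition of the weak derivative then moves the derivative back onto `φ`. -/
theorem hasDerivAt_inner_shift {φ η : L2 d} (h : HasWeakDeriv j φ η) {w : L2 d} {θ : Space d → ℂ}
    (hw : w =ᵐ[volume] θ) (hθ : ContDiff ℝ (⊤ : ℕ∞) θ) (hθc : HasCompactSupport θ) (s : ℝ) :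
    HasDerivAt (fun s : ℝ => ⟪w, shift (s • basisVec j) φ⟫_ℂ) ⟪w, shift (s • basisVec j) η⟫_ℂ s := by
  set ϑ : Space d → ℂ := fun x => (starRingEnd ℂ) (θ x) with hϑ
  have hϑs : ContDiff ℝ (⊤ : ℕ∞) ϑ := Complex.conjCLE.contDiff.comp hθ
  have hϑc : HasCompactSupport ϑ := hθc.comp_left (g := starRingEnd ℂ) (map_zero _)
  have key : ∀ (ψ : L2 d) (s : ℝ), ⟪w, shift (s • basisVec j) ψ⟫_ℂ
      = ∫ x, ϑ (x - s • basisVec j) * ψ x := by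
    intro ψ s
    rw [inner_eq_integral_of_ae_eq hw (coeFn_shift _ ψ), ← integral_sub_right_eq_self _
      (s • basisVec j)]
    simp only [sub_add_cancel, hϑ]
  have h1 := hasDerivAt_integral_comp_sub h.left hϑs hϑc (basisVec j) s
  simp only [key]
  convert h1 using 1
  have h2 := h.integral_eq_complex (θ := fun x => ϑ (x - s • basisVec j))
    (hϑs.comp (contDiff_id.sub contDiff_const))
    (hϑc.comp_homeomorph (Homeomorph.subRight _))
  simp only [fderiv_comp_sub] at h2
  rw [h2, neg_neg]

/-- The mean value inequality gives the bound weakly, against smooth `w`. Density extends it to all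
`w`, and `w` is then taken to be the difference itself. -/
theorem norm_shift_sub_le {φ η : L2 d} (h : HasWeakDeriv j φ η) (t : ℝ) :
    ‖shift (t • basisVec j) φ - φ‖ ≤ ‖η‖ * |t| := by
  have hdense := Lp.dense_hasCompactSupport_contDiff (E := Space d) (F := ℂ) (p := 2)
    (μ := volume) (by simp)
  have h1 : ∀ w : L2 d, ‖⟪w, shift (t • basisVec j) φ - φ⟫_ℂ‖ ≤ ‖w‖ * (‖η‖ * |t|) := by
    intro w
    refine hdense.induction (P := fun w : L2 d =>
      ‖⟪w, shift (t • basisVec j) φ - φ⟫_ℂ‖ ≤ ‖w‖ * (‖η‖ * |t|)) ?_ ?_ w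
    · rintro w ⟨θ, hw, hθc, hθ⟩
      have h2 := Convex.norm_image_sub_le_of_norm_hasDerivWithin_le
        (f := fun s : ℝ => ⟪w, shift (s • basisVec j) φ⟫_ℂ) (s := Set.univ) (x := 0) (y := t)
        (C := ‖w‖ * ‖η‖)
        (fun s _ => (hasDerivAt_inner_shift h hw hθ hθc s).hasDerivWithinAt)
        (fun s _ => (norm_inner_le_norm _ _).trans_eq (by rw [LinearIsometry.norm_map]))
        convex_univ (Set.mem_univ _) (Set.mem_univ _)
      simp only [zero_smul, shift_zero, sub_zero, Real.norm_eq_abs] at h2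
      rw [inner_sub_right]
      exact h2.trans_eq (mul_assoc _ _ _)
    · exact isClosed_le (by fun_prop) (by fun_prop)
  by_contra! hlt
  set ψ := shift (t • basisVec j) φ - φ with hψ
  have h2 := h1 ψ
  rw [inner_self_eq_norm_sq_to_K] at h2
  have hpos : 0 < ‖ψ‖ := lt_of_le_of_lt (by positivity) hlt
  have h3 : ‖ψ‖ * ‖ψ‖ ≤ ‖ψ‖ * (‖η‖ * |t|) := by
    refine le_trans (le_of_eq ?_) h2
    rw [norm_pow, RCLike.norm_ofReal, abs_norm, sq]
  exact absurd (le_of_mul_le_mul_left h3 hpos) (not_le.2 hlt)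

/-- The difference quotients of `φ` are bounded by `‖η‖` uniformly in `t`, so the smooth case passes
to every `w` by density. -/
theorem hasDerivAt_inner_shift_zero {φ η : L2 d} (h : HasWeakDeriv j φ η) (w : L2 d) :
    HasDerivAt (fun s : ℝ => ⟪w, shift (s • basisVec j) φ⟫_ℂ) ⟪w, η⟫_ℂ 0 := by
  rw [hasDerivAt_iff_tendsto_slope_zero, Metric.tendsto_nhds]
  intro ε hε
  have hdense := Lp.dense_hasCompactSupport_contDiff (E := Space d) (F := ℂ) (p := 2)
    (μ := volume) (by simp)
  -- Replacing `w` by `w'` causes two errors, each at most `‖w - w'‖ ‖η‖ ≤ ε / 4`; the `+ 1` covers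
  -- `η = 0`.
  obtain ⟨w', ⟨θ, hw', hθc, hθ⟩, hdist⟩ :=
    hdense.exists_dist_lt w (ε := ε / (4 * (‖η‖ + 1))) (by positivity)
  have h1 := hasDerivAt_inner_shift h hw' hθ hθc 0
  rw [hasDerivAt_iff_tendsto_slope_zero, Metric.tendsto_nhds] at h1
  filter_upwards [h1 (ε / 2) (by positivity), self_mem_nhdsWithin] with t ht ht0
  simp only [zero_add, zero_smul, shift_zero, dist_eq_norm, ← inner_sub_right] at ht ⊢
  set ψ := shift (t • basisVec j) φ - φ with hψ
  have hb : ‖ψ‖ ≤ ‖η‖ * |t| := norm_shift_sub_le h t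
  have ht0' : 0 < |t| := abs_pos.2 ht0
  have hb' : ‖t⁻¹ • ⟪w - w', ψ⟫_ℂ‖ ≤ ‖w - w'‖ * ‖η‖ := by
    rw [norm_smul, norm_inv, Real.norm_eq_abs, inv_mul_le_iff₀ ht0']
    calc ‖⟪w - w', ψ⟫_ℂ‖ ≤ ‖w - w'‖ * ‖ψ‖ := norm_inner_le_norm _ _
      _ ≤ ‖w - w'‖ * (‖η‖ * |t|) := by gcongr
      _ = _ := by ring
  have hb2 : ‖⟪w - w', η⟫_ℂ‖ ≤ ‖w - w'‖ * ‖η‖ := norm_inner_le_norm _ _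
  have hsplit : t⁻¹ • ⟪w, ψ⟫_ℂ - ⟪w, η⟫_ℂ
      = (t⁻¹ • ⟪w', ψ⟫_ℂ - ⟪w', η⟫_ℂ) + (t⁻¹ • ⟪w - w', ψ⟫_ℂ - ⟪w - w', η⟫_ℂ) := by
    simp only [inner_sub_left, smul_sub]
    ring
  have hsmall : ‖w - w'‖ * ‖η‖ ≤ ε / 4 := by
    rw [dist_eq_norm] at hdist
    calc ‖w - w'‖ * ‖η‖ ≤ (ε / (4 * (‖η‖ + 1))) * (‖η‖ + 1) := by
          gcongr
          linarith
      _ = ε / 4 := by field_simp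
  rw [hsplit]
  refine (norm_add_le _ _).trans_lt ?_
  have := norm_sub_le (t⁻¹ • ⟪w - w', ψ⟫_ℂ) ⟪w - w', η⟫_ℂ
  linarith

/-- Integration by parts for functions in the Sobolev space `H¹(ℝᵈ)`. -/
theorem inner_weakDeriv_eq_neg {φ η ψ ζ : L2 d} (h : HasWeakDeriv j φ η)
    (h' : HasWeakDeriv j ψ ζ) : ⟪ψ, η⟫_ℂ = - ⟪ζ, φ⟫_ℂ := by
  have h1 := hasDerivAt_inner_shift_zero h ψ
  have h2 := hasDerivAt_inner_shift_zero h' φ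
  -- Since translation by `-a` is adjoint to translation by `a`, this function is the conjugate of
  -- the one in `h1`; comparing the two derivatives at `0` gives the formula.
  have h3 : HasDerivAt (fun s : ℝ => ⟪φ, shift (-s • basisVec j) ψ⟫_ℂ) (-⟪φ, ζ⟫_ℂ) 0 := by
    have h2' : HasDerivAt (fun s : ℝ => ⟪φ, shift (s • basisVec j) ψ⟫_ℂ) ⟪φ, ζ⟫_ℂ (-0) := by
      simpa using h2
    have h3 := h2'.scomp (0 : ℝ) (hasDerivAt_neg (0 : ℝ))
    rw [neg_one_smul] at h3
    exact h3
  have h4 := (Complex.conjCLE.hasFDerivAt.comp_hasDerivAt (0 : ℝ) h3)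
  have h5 : (Complex.conjCLE ∘ fun s : ℝ => ⟪φ, shift (-s • basisVec j) ψ⟫_ℂ)
      = fun s : ℝ => ⟪ψ, shift (s • basisVec j) φ⟫_ℂ := by
    ext s
    rw [inner_shift_right, ← inner_conj_symm, ← neg_smul]
    rfl
  rw [h5] at h4
  have h6 := h1.unique h4
  rw [h6]
  simp

end WeakDerivatives

/-! ### The chain rule for weak derivatives -/

section ChainRule

variable {d : ℕ} {j : Fin d}

theorem integrable_norm_sq (ψ : L2 d) : Integrable fun x => ‖ψ x‖ ^ 2 := by
  have := (Lp.memLp ψ).integrable_norm_pow (by norm_num)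
  simpa using this

theorem integral_norm_sq (ψ : L2 d) : ∫ x, ‖ψ x‖ ^ 2 = ‖ψ‖ ^ 2 := by
  have h : ((∫ x, ‖ψ x‖ ^ 2 : ℝ) : ℂ) = ((‖ψ‖ ^ 2 : ℝ) : ℂ) := by
    have h1 := inner_self_eq_norm_sq_to_K (𝕜 := ℂ) ψ
    rw [L2.inner_def] at h1
    rw [← integral_complex_ofReal, Complex.ofReal_pow]
    refine Eq.trans ?_ h1
    refine integral_congr_ae (.of_forall fun x => ?_)
    simp only [inner_self_eq_norm_sq_to_K, Complex.ofReal_pow]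
    rfl
  exact_mod_cast h

theorem locallyIntegrable_of_bounded {f : Space d → ℝ} (hf : AEStronglyMeasurable f)
    {M : ℝ} (hM : ∀ x, |f x| ≤ M) : LocallyIntegrable f :=
  (memLp_top_of_bound hf M (.of_forall hM)).locallyIntegrable le_top

/-- Chain rule in `H¹(ℝᵈ)`. -/
theorem HasWeakDeriv.comp_of_memLp {u g : Space d → ℝ} (h : HasWeakDeriv j u g)
    (hu : MemLp u 2) (hg : MemLp g 2) {F F' : ℝ → ℝ} (hF : Continuous F) (hF' : Continuous F')
    {M M' C : ℝ} (hM : ∀ x, |F x| ≤ M) (hM' : ∀ x, |F' x| ≤ M')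
    (hC : ∀ a b, |F a - F b - F' b * (a - b)| ≤ C * |a - b| ^ 2) :
    HasWeakDeriv j (fun x => F (u x)) (fun x => F' (u x) * g x) := by
  have hFu : AEStronglyMeasurable fun x => F (u x) :=
    hF.comp_aestronglyMeasurable hu.aestronglyMeasurable
  have hF'u : AEStronglyMeasurable fun x => F' (u x) :=
    hF'.comp_aestronglyMeasurable hu.aestronglyMeasurable
  have hFl : LocallyIntegrable fun x => F (u x) := locallyIntegrable_of_bounded hFu fun x => hM _
  have hFl' : LocallyIntegrable fun x => ((F (u x) : ℝ) : ℂ) :=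
    fun x => (hFl x).imp fun s hs => ⟨hs.1, hs.2.ofReal⟩
  have hF'g : MemLp (fun x => F' (u x) * g x) 2 :=
    hg.of_le_mul (c := M') (hF'u.mul hg.aestronglyMeasurable) (.of_forall fun x => by
      rw [norm_mul]
      exact mul_le_mul_of_nonneg_right (hM' _) (norm_nonneg _))
  have hC0 : 0 ≤ C := by
    have := (abs_nonneg _).trans (hC 1 0)
    simpa using this
  refine ⟨hFl, hF'g.locallyIntegrable (by norm_num), fun θ hθ hθc => ?_⟩
  obtain ⟨B, hB⟩ := hθc.exists_bound_of_continuous hθ.continuous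
  set φ : L2 d := hu.ofReal.toLp _ with hφ
  set η : L2 d := hg.ofReal.toLp _ with hη
  have hφ' : φ =ᵐ[volume] fun x => (u x : ℂ) := MemLp.coeFn_toLp _
  have hη' : η =ᵐ[volume] fun x => (g x : ℂ) := MemLp.coeFn_toLp _
  have hw : MemLp (fun x => θ x * F' (u x)) 2 :=
    (hθ.continuous.memLp_of_hasCompactSupport hθc).of_le_mul (c := M')
      (hθ.continuous.aestronglyMeasurable.mul hF'u) (.of_forall fun x => by
        rw [norm_mul, mul_comm]
        exact mul_le_mul_of_nonneg_right (hM' _) (norm_nonneg _))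
  set w : L2 d := hw.ofReal.toLp _ with hw_def
  have hw' : w =ᵐ[volume] fun x => ((θ x * F' (u x) : ℝ) : ℂ) := MemLp.coeFn_toLp _
  have hweak : HasWeakDeriv j φ η := h.ofReal.congr hφ'.symm hη'.symm
  set ϑ : Space d → ℂ := fun x => (θ x : ℂ) with hϑ
  have hϑs : ContDiff ℝ (⊤ : ℕ∞) ϑ := Complex.ofRealCLM.contDiff.comp hθ
  have hϑc : HasCompactSupport ϑ := hθc.comp_left (g := fun r : ℝ => (r : ℂ)) Complex.ofReal_zero
  set e : Space d := basisVec j with he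
  -- The derivative of `I` at `0` is computed twice. With the translation on `θ` it is `-∫ ∂θ F(u)`.
  -- With the translation on `u` it is `∫ θ F'(u) g`, because the Taylor remainder `R` is controlled
  -- by `‖u(· + s e) - u‖² = O(s²)`.
  set I : ℝ → ℂ := fun s => ∫ x, ϑ (x - s • e) * ((F (u x) : ℝ) : ℂ) with hI
  have hI1 : HasDerivAt I (- ∫ x, fderiv ℝ ϑ (x - (0 : ℝ) • e) e * ((F (u x) : ℝ) : ℂ)) 0 :=
    hasDerivAt_integral_comp_sub hFl' hϑs hϑc e 0
  have hIs : ∀ s, I s = ∫ x, ϑ x * ((F (u (x + s • e)) : ℝ) : ℂ) := fun s => by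
    simp only [hI]
    rw [← integral_add_right_eq_self _ (s • e)]
    simp only [add_sub_cancel_right]
  have hint : ∀ s : ℝ, Integrable fun x => ϑ x * ((F (u (x + s • e)) : ℝ) : ℂ) := fun s =>
    (LocallyIntegrable.comp_add_right hFl' (s • e)).integrable_smul_left_of_hasCompactSupport
      hϑs.continuous hϑc
  set R : ℝ → ℂ := fun s => I s - I 0 - (⟪w, shift (s • e) φ⟫_ℂ - ⟪w, φ⟫_ℂ) with hR
  have hRb : ∀ s, ‖R s‖ ≤ (B * C * ‖η‖ ^ 2) * ‖s - 0‖ ^ 2 := by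
    intro s
    set ψ : L2 d := shift (s • e) φ - φ with hψ
    have hψ' : ∀ᵐ x, ψ x = ((u (x + s • e) - u x : ℝ) : ℂ) := by
      filter_upwards [Lp.coeFn_sub (shift (s • e) φ) φ, coeFn_shift (s • e) φ, hφ',
        ae_comp_add_right hφ' (s • e)] with x h1 h2 h3 h4
      rw [h1, Pi.sub_apply, h2, h3, h4, Complex.ofReal_sub]
    have hi3 : Integrable fun x => ⟪w x, ψ x⟫_ℂ := L2.integrable_inner w ψ
    have hRs : R s = ∫ x, (ϑ x * ((F (u (x + s • e)) : ℝ) : ℂ)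
        - ϑ x * ((F (u (x + (0 : ℝ) • e)) : ℝ) : ℂ) - ⟪w x, ψ x⟫_ℂ) := by
      have hi12 : Integrable fun x => ϑ x * ((F (u (x + s • e)) : ℝ) : ℂ)
          - ϑ x * ((F (u (x + (0 : ℝ) • e)) : ℝ) : ℂ) := (hint s).sub (hint 0)
      rw [integral_sub hi12 hi3, integral_sub (hint s) (hint 0), ← hIs, ← hIs,
        ← L2.inner_def, hψ, inner_sub_right]
    have hBψ : B * C * ‖ψ‖ ^ 2 = ∫ x, B * C * ‖ψ x‖ ^ 2 := by
      rw [integral_const_mul, integral_norm_sq]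
    have hB0 : 0 ≤ B := (norm_nonneg _).trans (hB 0)
    have h1 : ‖R s‖ ≤ B * C * ‖ψ‖ ^ 2 := by
      rw [hRs, hBψ]
      refine norm_integral_le_of_norm_le ((integrable_norm_sq ψ).const_mul _) ?_
      filter_upwards [hψ', hw'] with x h1 h2
      rw [h1, h2, RCLike.inner_apply, zero_smul, add_zero]
      have : ϑ x * ((F (u (x + s • e)) : ℝ) : ℂ) - ϑ x * ((F (u x) : ℝ) : ℂ)
          - ((u (x + s • e) - u x : ℝ) : ℂ) * (starRingEnd ℂ) ((θ x * F' (u x) : ℝ) : ℂ)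
          = ((θ x * (F (u (x + s • e)) - F (u x) - F' (u x) * (u (x + s • e) - u x)) : ℝ) : ℂ) := by
        rw [Complex.conj_ofReal]
        simp only [hϑ]
        push_cast
        ring
      rw [this, Complex.norm_real, Complex.norm_real, norm_mul, mul_assoc]
      exact mul_le_mul (hB x) (hC _ _) (norm_nonneg _) hB0
    have h2 := norm_shift_sub_le hweak s
    calc ‖R s‖ ≤ B * C * ‖ψ‖ ^ 2 := h1
      _ ≤ B * C * (‖η‖ * |s|) ^ 2 := by gcongr
      _ = _ := by rw [sub_zero, Real.norm_eq_abs]; ring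
  have hR' : HasDerivAt R 0 0 := by
    have : R =O[nhds 0] fun s => ‖s - 0‖ ^ 2 :=
      Asymptotics.IsBigO.of_bound (B * C * ‖η‖ ^ 2) (.of_forall fun s => by
        rw [norm_pow, norm_norm]
        exact hRb s)
    have h1 := (this.hasFDerivAt (by norm_num)).hasDerivAt
    simpa using h1
  have hI2 : HasDerivAt I ⟪w, η⟫_ℂ 0 := by
    have h1 := (hR'.add ((hasDerivAt_inner_shift_zero hweak w).sub_const ⟪w, φ⟫_ℂ)).add_const (I 0)
    rw [zero_add] at h1
    refine h1.congr_of_eventuallyEq (.of_forall fun s => ?_)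
    simp only [hR, Pi.add_apply]
    ring
  have hfin := hI1.unique hI2
  rw [inner_eq_integral_of_ae_eq hw' hη'] at hfin
  have hfd : ∀ x, fderiv ℝ ϑ x e = ((fderiv ℝ θ x e : ℝ) : ℂ) := fun x => by
    have := (Complex.ofRealCLM.hasFDerivAt.comp x
      (hθ.differentiable (by simp) x).hasFDerivAt).fderiv
    exact congrArg (fun L : Space d →L[ℝ] ℂ => L e) this
  have e1 : ∫ x, fderiv ℝ ϑ (x - (0 : ℝ) • e) e * ((F (u x) : ℝ) : ℂ)
      = ((∫ x, fderiv ℝ θ x e * F (u x) : ℝ) : ℂ) := by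
    rw [← integral_complex_ofReal]
    simp only [zero_smul, sub_zero, hfd, Complex.ofReal_mul]
  have e2 : ∫ x, (starRingEnd ℂ) ((θ x * F' (u x) : ℝ) : ℂ) * (g x : ℂ)
      = ((∫ x, θ x * (F' (u x) * g x) : ℝ) : ℂ) := by
    rw [← integral_complex_ofReal]
    simp only [Complex.ofReal_mul, map_mul, Complex.conj_ofReal, mul_assoc]
  rw [e1, e2] at hfin
  have hfin' : -∫ x, fderiv ℝ θ x e * F (u x) = ∫ x, θ x * (F' (u x) * g x) := by
    exact_mod_cast hfin
  simp only [smul_eq_mul]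
  rw [← hfin', neg_neg]

/-- Functions that are square integrable on bounded sets. -/
def MemL2Loc (f : Space d → ℝ) : Prop :=
  AEStronglyMeasurable f ∧ ∀ R : ℝ, MemLp f 2 (volume.restrict (Metric.closedBall 0 R))

theorem MemL2Loc.locallyIntegrable {f : Space d → ℝ} (hf : MemL2Loc f) : LocallyIntegrable f := by
  rw [locallyIntegrable_iff]
  intro K hK
  obtain ⟨R, hR⟩ := hK.isBounded.subset_closedBall 0
  have : IsFiniteMeasure (volume.restrict (Metric.closedBall (0 : Space d) R)) :=
    ⟨by simpa using measure_closedBall_lt_top⟩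
  exact IntegrableOn.mono_set ((hf.2 R).integrable (by norm_num)) hR

theorem MemL2Loc.memLp_mul {f : Space d → ℝ} (hf : MemL2Loc f) {θ : Space d → ℝ}
    (hθ : Continuous θ) (hθc : HasCompactSupport θ) : MemLp (fun x => θ x * f x) 2 := by
  obtain ⟨R, hR⟩ := hθc.isCompact.isBounded.subset_closedBall 0
  obtain ⟨B, hB⟩ := hθc.exists_bound_of_continuous hθ
  have h1 : MemLp (fun x => θ x * f x) 2 (volume.restrict (Metric.closedBall 0 R)) :=
    (hf.2 R).of_le_mul (c := B) (hθ.aestronglyMeasurable.mul hf.1.restrict)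
      (.of_forall fun x => by
        rw [norm_mul]
        exact mul_le_mul_of_nonneg_right (hB x) (norm_nonneg _))
  rw [← memLp_indicator_iff_restrict Metric.isClosed_closedBall.measurableSet] at h1
  convert h1 using 1
  ext x
  by_cases hx : x ∈ Metric.closedBall 0 R
  · rw [Set.indicator_of_mem hx]
  · rw [Set.indicator_of_notMem hx, image_eq_zero_of_notMem_tsupport fun h => hx (hR h), zero_mul]

/-- Chain rule in `H¹_loc(ℝᵈ)`. -/
theorem HasWeakDeriv.comp {u g : Space d → ℝ} (h : HasWeakDeriv j u g)
    (hu : MemL2Loc u) (hg : MemL2Loc g) {F F' : ℝ → ℝ} (hF : Continuous F) (hF' : Continuous F')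
    {M M' C : ℝ} (hM : ∀ x, |F x| ≤ M) (hM' : ∀ x, |F' x| ≤ M')
    (hC : ∀ a b, |F a - F b - F' b * (a - b)| ≤ C * |a - b| ^ 2) :
    HasWeakDeriv j (fun x => F (u x)) (fun x => F' (u x) * g x) := by
  have hFu : AEStronglyMeasurable fun x => F (u x) := hF.comp_aestronglyMeasurable hu.1
  have hF'u : AEStronglyMeasurable fun x => F' (u x) := hF'.comp_aestronglyMeasurable hu.1
  refine ⟨locallyIntegrable_of_bounded hFu fun x => hM _, ?_, fun θ hθ hθc => ?_⟩
  · refine (hg.locallyIntegrable.smul M').mono (hF'u.mul hg.1) (.of_forall fun x => ?_)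
    rw [norm_mul, Pi.smul_apply, norm_smul]
    exact mul_le_mul_of_nonneg_right ((hM' _).trans (le_abs_self _)) (norm_nonneg _)
  -- A cutoff `b` equal to one near the support of `θ` replaces `u` by `b u ∈ H¹(ℝᵈ)` without
  -- changing either integral.
  obtain ⟨R, hR0, hR⟩ := hθc.isCompact.isBounded.subset_ball_lt 0 0
  let b : ContDiffBump (0 : Space d) := ⟨R, R + 1, hR0, by linarith⟩
  have hbs : ContDiff ℝ (⊤ : ℕ∞) b := b.contDiff
  have hbs' : Continuous fun x => fderiv ℝ b x (basisVec j) :=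
    (hbs.continuous_fderiv (by simp)).clm_apply continuous_const
  have h1 := h.smul hbs
  simp only [smul_eq_mul] at h1
  have h2 := h1.comp_of_memLp (hu.memLp_mul hbs.continuous b.hasCompactSupport)
    ((hg.memLp_mul hbs.continuous b.hasCompactSupport).add
      (hu.memLp_mul hbs' (b.hasCompactSupport.fderiv_apply (𝕜 := ℝ) _))) hF hF' hM hM' hC
  have h3 := h2.integral_eq θ hθ hθc
  have hb1 : ∀ x ∈ tsupport θ, b x = 1 := fun x hx =>
    b.one_of_mem_closedBall (Metric.ball_subset_closedBall (hR hx))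
  have hb2 : ∀ x ∈ tsupport θ, fderiv ℝ b x = 0 := fun x hx => by
    have : (b : Space d → ℝ) =ᶠ[nhds x] fun _ => 1 := b.eventuallyEq_one_of_mem_ball (hR hx)
    rw [this.fderiv_eq]
    simp
  convert h3 using 1
  · refine integral_congr_ae (.of_forall fun x => ?_)
    by_cases hx : x ∈ tsupport θ
    · simp only [hb1 x hx, one_mul]
    · have : fderiv ℝ θ x = 0 :=
        image_eq_zero_of_notMem_tsupport fun h => hx (tsupport_fderiv_subset ℝ h)
      simp [this]
  · congr 1
    refine integral_congr_ae (.of_forall fun x => ?_)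
    by_cases hx : x ∈ tsupport θ
    · simp [hb1 x hx, hb2 x hx]
    · simp [image_eq_zero_of_notMem_tsupport hx]

/-- A smooth compactly supported function of one variable satisfies the bounds that the
chain rule needs. -/
theorem exists_taylor_bound {F : ℝ → ℝ} (hF : ContDiff ℝ (⊤ : ℕ∞) F) (hFc : HasCompactSupport F) :
    ∃ C, ∀ a b, |F a - F b - deriv F b * (a - b)| ≤ C * |a - b| ^ 2 := by
  have hF1 : ContDiff ℝ (⊤ : ℕ∞) (deriv F) := hF.iterate_deriv 1
  have hF2 : ContDiff ℝ (⊤ : ℕ∞) (deriv (deriv F)) := hF.iterate_deriv 2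
  obtain ⟨C, hC⟩ := hFc.deriv.deriv.exists_bound_of_continuous hF2.continuous
  have hC0 : 0 ≤ C := (norm_nonneg _).trans (hC 0)
  have hlip : ∀ x y, ‖deriv F y - deriv F x‖ ≤ C * ‖y - x‖ := fun x y =>
    Convex.norm_image_sub_le_of_norm_hasDerivWithin_le (s := Set.univ)
      (fun z _ => (hF1.differentiable (by simp) z).hasDerivAt.hasDerivWithinAt)
      (fun z _ => hC z) convex_univ (Set.mem_univ _) (Set.mem_univ _)
  refine ⟨C, fun a b => ?_⟩
  have h := Convex.norm_image_sub_le_of_norm_hasDerivWithin_le (s := Set.uIcc b a) (x := b) (y := a)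
    (f := fun x => F x - deriv F b * x) (f' := fun x => deriv F x - deriv F b) (C := C * |a - b|)
    (fun z _ => by
      have := (hF.differentiable (by simp) z).hasDerivAt.sub
        ((hasDerivAt_id z).const_mul (deriv F b))
      rw [mul_one] at this
      exact this.hasDerivWithinAt)
    (fun z hz => (hlip b z).trans
      (mul_le_mul_of_nonneg_left (Set.abs_sub_left_of_mem_uIcc hz) hC0))
    (convex_uIcc _ _) Set.left_mem_uIcc Set.right_mem_uIcc
  calc |F a - F b - deriv F b * (a - b)|
      = ‖F a - deriv F b * a - (F b - deriv F b * b)‖ := by rw [Real.norm_eq_abs]; ring_nf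
    _ ≤ C * |a - b| * ‖a - b‖ := h
    _ = C * |a - b| ^ 2 := by rw [Real.norm_eq_abs]; ring

theorem HasWeakDeriv.comp_contDiff {u g : Space d → ℝ} (h : HasWeakDeriv j u g)
    (hu : MemL2Loc u) (hg : MemL2Loc g) {F : ℝ → ℝ} (hF : ContDiff ℝ (⊤ : ℕ∞) F)
    (hFc : HasCompactSupport F) :
    HasWeakDeriv j (fun x => F (u x)) (fun x => deriv F (u x) * g x) := by
  obtain ⟨C, hC⟩ := exists_taylor_bound hF hFc
  have hF1 : Continuous (deriv F) := hF.continuous_deriv (by simp)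
  obtain ⟨M, hM⟩ := hFc.exists_bound_of_continuous hF.continuous
  obtain ⟨M', hM'⟩ := hFc.deriv.exists_bound_of_continuous hF1
  exact h.comp hu hg hF.continuous hF1 hM hM' hC

end ChainRule

/-! ### Quadratic partitions of unity in the values of `u` and in space -/

section Partition

/-- A smooth function on the line, supported in `[-1, 1]`, the squares of whose integer
translates sum up to one. -/
noncomputable def eta (s : ℝ) : ℝ :=
  Real.cos (Real.pi / 2 * Real.smoothTransition s) *
    Real.sin (Real.pi / 2 * Real.smoothTransition (s + 1))

theorem contDiff_eta : ContDiff ℝ (⊤ : ℕ∞) eta := by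
  have h1 : ContDiff ℝ (⊤ : ℕ∞) Real.smoothTransition := Real.smoothTransition.contDiff
  have h2 : ContDiff ℝ (⊤ : ℕ∞) fun s : ℝ => Real.smoothTransition (s + 1) :=
    h1.comp (contDiff_id.add contDiff_const)
  exact (Real.contDiff_cos.comp (contDiff_const.mul h1)).mul
    (Real.contDiff_sin.comp (contDiff_const.mul h2))

theorem eta_eq_zero {s : ℝ} (hs : 1 ≤ |s|) : eta s = 0 := by
  rcases le_abs.1 hs with h | h
  · rw [eta, Real.smoothTransition.one_of_one_le h, mul_one, Real.cos_pi_div_two, zero_mul]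
  · rw [eta, Real.smoothTransition.zero_of_nonpos (x := s + 1) (by linarith), mul_zero,
      Real.sin_zero, mul_zero]

theorem eta_nonneg (s : ℝ) : 0 ≤ eta s := by
  have hpi := Real.pi_pos
  have h0 := Real.smoothTransition.nonneg
  have h1 := Real.smoothTransition.le_one
  refine mul_nonneg (Real.cos_nonneg_of_mem_Icc ⟨?_, ?_⟩) (Real.sin_nonneg_of_nonneg_of_le_pi ?_ ?_)
  · nlinarith [h0 s, h1 s]
  · nlinarith [h0 s, h1 s]
  · nlinarith [h0 (s + 1), h1 (s + 1)]
  · nlinarith [h0 (s + 1), h1 (s + 1)]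

theorem abs_eta_le_one (s : ℝ) : |eta s| ≤ 1 := by
  rw [eta, abs_mul]
  exact mul_le_one₀ (Real.abs_cos_le_one _) (abs_nonneg _) (Real.abs_sin_le_one _)

/-- Every such point, including the endpoints `±1`, is a minimum of the nonnegative function `eta`.
The endpoints matter, since `tsum_translates` asks for vanishing on `1 ≤ |s|`. -/
theorem deriv_eta_eq_zero {s : ℝ} (hs : 1 ≤ |s|) : deriv eta s = 0 := by
  refine IsLocalMin.deriv_eq_zero (.of_forall fun t => ?_)
  rw [eta_eq_zero hs]
  exact eta_nonneg t

theorem hasCompactSupport_eta : HasCompactSupport eta := by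
  refine HasCompactSupport.of_support_subset_isCompact (isCompact_Icc (a := -1) (b := 1)) ?_
  intro s hs
  by_contra h
  refine hs (eta_eq_zero ?_)
  by_contra! hlt
  exact h ⟨(abs_lt.1 hlt).1.le, (abs_lt.1 hlt).2.le⟩

/-- On `[0, 1]` the two translates are the cosine and the sine of the same angle. -/
theorem eta_sq_add_eta_sq {t : ℝ} (h0 : 0 ≤ t) (h1 : t ≤ 1) : eta t ^ 2 + eta (t - 1) ^ 2 = 1 := by
  rw [eta, eta, Real.smoothTransition.one_of_one_le (x := t + 1) (by linarith),
    Real.smoothTransition.zero_of_nonpos (x := t - 1) (by linarith), sub_add_cancel, mul_one,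
    Real.sin_pi_div_two, mul_zero, Real.cos_zero, mul_one, one_mul, add_comm]
  exact Real.sin_sq_add_cos_sq _

theorem enorm_sq_eq_ofReal (x : ℝ) : ‖x‖ₑ ^ 2 = ENNReal.ofReal (x ^ 2) := by
  rw [← ofReal_norm, ← ENNReal.ofReal_pow (norm_nonneg _), Real.norm_eq_abs, sq_abs]

theorem enorm_add_sq_le (a b : ℝ) : ‖a + b‖ₑ ^ 2 ≤ 2 * (‖a‖ₑ ^ 2 + ‖b‖ₑ ^ 2) := by
  rw [enorm_sq_eq_ofReal, enorm_sq_eq_ofReal, enorm_sq_eq_ofReal,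
    ← ENNReal.ofReal_add (sq_nonneg _) (sq_nonneg _), ← ENNReal.ofReal_ofNat,
    ← ENNReal.ofReal_mul (by norm_num)]
  exact ENNReal.ofReal_le_ofReal add_sq_le

theorem enorm_eta_sq_add {t : ℝ} (h0 : 0 ≤ t) (h1 : t ≤ 1) :
    ‖eta t‖ₑ ^ 2 + ‖eta (t - 1)‖ₑ ^ 2 = 1 := by
  rw [enorm_sq_eq_ofReal, enorm_sq_eq_ofReal, ← ENNReal.ofReal_add (sq_nonneg _) (sq_nonneg _),
    eta_sq_add_eta_sq h0 h1, ENNReal.ofReal_one]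

theorem exists_deriv_eta_bound : ∃ M : ℝ≥0∞, M ≠ ∞ ∧ ∀ s, ‖deriv eta s‖ₑ ^ 2 ≤ M := by
  obtain ⟨M, hM⟩ := hasCompactSupport_eta.deriv.exists_bound_of_continuous
    (contDiff_eta.continuous_deriv (by simp))
  refine ⟨ENNReal.ofReal M ^ 2, (ENNReal.pow_lt_top ENNReal.ofReal_lt_top).ne, fun s => ?_⟩
  gcongr
  rw [← ofReal_norm]
  exact ENNReal.ofReal_le_ofReal (hM s)

theorem one_le_abs_sub_intCast {s : ℝ} {n : ℤ} (h1 : n ≠ ⌊s⌋) (h2 : n ≠ ⌊s⌋ + 1) :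
    1 ≤ |s - n| := by
  rcases lt_or_gt_of_ne h1 with h | h
  · have h3 : (n : ℝ) + 1 ≤ ⌊s⌋ := by exact_mod_cast h
    have h4 := Int.floor_le s
    exact le_abs.2 (.inl (by linarith))
  · have h3 : ((⌊s⌋ : ℝ) + 1) + 1 ≤ n := by
      have : ⌊s⌋ + 1 + 1 ≤ n := by omega
      exact_mod_cast this
    have h4 := Int.lt_floor_add_one s
    exact le_abs.2 (.inr (by linarith))

theorem sum_floor_pair (h : ℝ → ℝ≥0∞) (s : ℝ) :
    ∑ n ∈ ({⌊s⌋, ⌊s⌋ + 1} : Finset ℤ), h (s - n) = h (Int.fract s) + h (Int.fract s - 1) := by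
  rw [Finset.sum_pair (by omega)]
  push_cast
  rw [← sub_sub, Int.self_sub_floor]

theorem tsum_translates {h : ℝ → ℝ≥0∞} (hh : ∀ s, 1 ≤ |s| → h s = 0) (s : ℝ) :
    ∑' n : ℤ, h (s - n) = h (Int.fract s) + h (Int.fract s - 1) := by
  rw [tsum_eq_sum (s := {⌊s⌋, ⌊s⌋ + 1}), sum_floor_pair]
  intro n hn
  simp only [Finset.mem_insert, Finset.mem_singleton, not_or] at hn
  exact hh _ (one_le_abs_sub_intCast hn.1 hn.2)

/-- In each coordinate only the indices `⌊s i⌋` and `⌊s i⌋ + 1` contribute, so the sum is finite and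
factorizes. -/
theorem tsum_prod_translates {d : ℕ} {h : Fin d → ℝ → ℝ≥0∞} (hh : ∀ i s, 1 ≤ |s| → h i s = 0)
    (s : Fin d → ℝ) :
    ∑' n : Fin d → ℤ, ∏ i, h i (s i - n i)
      = ∏ i, (h i (Int.fract (s i)) + h i (Int.fract (s i) - 1)) := by
  rw [tsum_eq_sum (s := Fintype.piFinset fun i => {⌊s i⌋, ⌊s i⌋ + 1})]
  · rw [← Finset.prod_univ_sum (fun i => ({⌊s i⌋, ⌊s i⌋ + 1} : Finset ℤ))
      (fun i n => h i (s i - n))]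
    exact Finset.prod_congr rfl fun i _ => sum_floor_pair _ _
  · intro n hn
    simp only [Fintype.mem_piFinset, Finset.mem_insert, Finset.mem_singleton, not_forall,
      not_or] at hn
    obtain ⟨i, hi1, hi2⟩ := hn
    exact Finset.prod_eq_zero (Finset.mem_univ i) (hh i _ (one_le_abs_sub_intCast hi1 hi2))

theorem enorm_finsetProd {ι : Type*} (s : Finset ι) (f : ι → ℝ) :
    ‖∏ i ∈ s, f i‖ₑ = ∏ i ∈ s, ‖f i‖ₑ := by
  simp only [enorm_eq_nnnorm, nnnorm_prod, ENNReal.ofNNReal_finsetProd]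

theorem enorm_eta_sq_eq_zero (s : ℝ) (hs : 1 ≤ |s|) : ‖eta s‖ₑ ^ 2 = 0 := by
  rw [eta_eq_zero hs]
  simp

theorem tsum_enorm_eta_sq (s : ℝ) : ∑' n : ℤ, ‖eta (s - n)‖ₑ ^ 2 = 1 := by
  rw [tsum_translates enorm_eta_sq_eq_zero]
  exact enorm_eta_sq_add (Int.fract_nonneg s) (Int.fract_lt_one s).le

/-- The part of `u` at the scale `|u| ∼ exp m`. -/
noncomputable def level (m : ℤ) (u : ℝ) : ℝ := u * eta (Real.log u - m)

theorem tsum_enorm_level_sq (u : ℝ) : ∑' m : ℤ, ‖level m u‖ₑ ^ 2 = ‖u‖ₑ ^ 2 := by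
  simp only [level, enorm_mul, mul_pow]
  rw [ENNReal.tsum_mul_left, tsum_enorm_eta_sq, mul_one]

theorem exp_lt_abs_lt_exp_of_level_ne_zero {m : ℤ} {u : ℝ} (h : level m u ≠ 0) :
    Real.exp (m - 1) < |u| ∧ |u| < Real.exp (m + 1) := by
  have hu : u ≠ 0 := fun h0 => h (by rw [level, h0, zero_mul])
  have h1 : |Real.log u - m| < 1 := by
    by_contra! hge
    exact h (by rw [level, eta_eq_zero hge, mul_zero])
  rw [← Real.log_abs] at h1
  obtain ⟨h2, h3⟩ := abs_lt.1 h1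
  exact ⟨(Real.lt_log_iff_exp_lt (abs_pos.2 hu)).1 (by linarith),
    (Real.log_lt_iff_lt_exp (abs_pos.2 hu)).1 (by linarith)⟩

theorem abs_level_le (m : ℤ) (u : ℝ) : |level m u| ≤ Real.exp (m + 1) := by
  by_cases h : level m u = 0
  · rw [h, abs_zero]
    exact (Real.exp_pos _).le
  · refine le_trans ?_ (exp_lt_abs_lt_exp_of_level_ne_zero h).2.le
    rw [level, abs_mul]
    exact mul_le_of_le_one_right (abs_nonneg _) (abs_eta_le_one _)

/-- A level avoids a neighbourhood of `0`, so the singularity of the logarithm does no harm to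
smoothness. -/
theorem level_eventuallyEq_zero (m : ℤ) : level m =ᶠ[nhds 0] fun _ => 0 := by
  filter_upwards [Metric.ball_mem_nhds (0 : ℝ) (Real.exp_pos ((m : ℝ) - 1))] with u hu
  by_contra h
  have h1 := (exp_lt_abs_lt_exp_of_level_ne_zero h).1
  rw [mem_ball_zero_iff, Real.norm_eq_abs] at hu
  exact absurd h1 (not_lt.2 hu.le)

theorem contDiff_level (m : ℤ) : ContDiff ℝ (⊤ : ℕ∞) (level m) := by
  rw [contDiff_iff_contDiffAt]
  intro u
  by_cases hu : u = 0
  · rw [hu]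
    exact contDiffAt_const.congr_of_eventuallyEq (level_eventuallyEq_zero m)
  · exact contDiffAt_id.mul (contDiff_eta.contDiffAt.comp u
      ((Real.contDiffAt_log.2 hu).sub contDiffAt_const))

theorem hasCompactSupport_level (m : ℤ) : HasCompactSupport (level m) := by
  refine HasCompactSupport.of_support_subset_isCompact
    (isCompact_closedBall (0 : ℝ) (Real.exp (m + 1))) fun u hu => ?_
  rw [mem_closedBall_zero_iff, Real.norm_eq_abs]
  exact (exp_lt_abs_lt_exp_of_level_ne_zero hu).2.le

/-- The factor `u` cancels the `1 / u` from the logarithm. The derivatives are therefore bounded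
uniformly in `m`, which is the reason for a logarithmic scale. -/
theorem deriv_level {m : ℤ} {u : ℝ} (hu : u ≠ 0) :
    deriv (level m) u = eta (Real.log u - m) + deriv eta (Real.log u - m) := by
  have h1 := (hasDerivAt_id u).mul (((contDiff_eta.differentiable (by simp)
    (Real.log u - m)).hasDerivAt).comp u ((Real.hasDerivAt_log hu).sub_const (m : ℝ)))
  refine h1.deriv.trans ?_
  simp only [id, one_mul, Function.comp_apply]
  field_simp

theorem exists_tsum_enorm_deriv_level_sq_le :
    ∃ C : ℝ≥0∞, C ≠ ∞ ∧ ∀ u, ∑' m : ℤ, ‖deriv (level m) u‖ₑ ^ 2 ≤ C := by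
  obtain ⟨M, hM, hMb⟩ := exists_deriv_eta_bound
  refine ⟨2 * (1 + (M + M)), by finiteness, fun u => ?_⟩
  by_cases hu : u = 0
  · have : ∀ m : ℤ, deriv (level m) u = 0 := fun m => by
      rw [hu, (level_eventuallyEq_zero m).deriv_eq, deriv_const]
    simp [this]
  · calc ∑' m : ℤ, ‖deriv (level m) u‖ₑ ^ 2
        ≤ ∑' m : ℤ, 2 * (‖eta (Real.log u - m)‖ₑ ^ 2 + ‖deriv eta (Real.log u - m)‖ₑ ^ 2) := by
          refine ENNReal.tsum_le_tsum fun m => ?_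
          rw [deriv_level hu]
          exact enorm_add_sq_le _ _
      _ ≤ 2 * (1 + (M + M)) := by
          rw [ENNReal.tsum_mul_left, ENNReal.tsum_add, tsum_enorm_eta_sq,
            tsum_translates (h := fun s => ‖deriv eta s‖ₑ ^ 2)]
          · gcongr <;> exact hMb _
          · intro s hs
            rw [deriv_eta_eq_zero hs]
            simp

/-- The inverse of the size of the cells used at the level `m`. -/
noncomputable def cellScale (m : ℤ) : ℕ := ⌈2 * Real.exp (2 * m + 2)⌉₊ + 2

/-- Makes (maximal value of `u²` on the level) × (bound `2 / cellScale m` on the volume of a cell)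
at most one. -/
theorem two_mul_exp_le_cellScale (m : ℤ) : 2 * Real.exp (2 * m + 2) ≤ cellScale m := by
  rw [cellScale]
  push_cast
  linarith [Nat.le_ceil (2 * Real.exp (2 * m + 2))]

theorem two_le_cellScale (m : ℤ) : (2 : ℝ) ≤ cellScale m := by
  rw [cellScale]
  push_cast
  have : (0 : ℝ) ≤ ⌈2 * Real.exp (2 * m + 2)⌉₊ := Nat.cast_nonneg _
  linarith

theorem cellScale_le (m : ℤ) : (cellScale m : ℝ) ≤ 2 * Real.exp (2 * m + 2) + 3 := by
  rw [cellScale]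
  push_cast
  linarith [Nat.ceil_lt_add_one (a := 2 * Real.exp (2 * m + 2)) (by positivity)]

/-- The lower bound `exp (m - 1) < |u|` on the level turns the scale into a power of `u`. With `u² =
ρ`, the cutting cost `cellScale² u²` becomes of order `ρ³ + ρ`. -/
theorem cellScale_le_of_level_ne_zero {m : ℤ} {u : ℝ} (h : level m u ≠ 0) :
    (cellScale m : ℝ) ≤ 2 * Real.exp 4 * u ^ 2 + 3 := by
  refine (cellScale_le m).trans ?_
  have h1 := (exp_lt_abs_lt_exp_of_level_ne_zero h).1
  have h2 : Real.exp (m - 1) ^ 2 ≤ u ^ 2 := by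
    rw [← sq_abs u]
    exact pow_le_pow_left₀ (Real.exp_pos _).le h1.le 2
  have h3 : Real.exp (2 * m + 2) = Real.exp 4 * Real.exp (m - 1) ^ 2 := by
    rw [← Real.exp_nat_mul, ← Real.exp_add]
    congr 1
    push_cast
    ring
  rw [h3]
  nlinarith [Real.exp_pos 4]

variable {d : ℕ}

/-- The function localizing in the cell with index `n ∈ ℤᵈ` at the level `m`. -/
noncomputable def cellFun (m : ℤ) (n : Fin d → ℤ) (x : Space d) : ℝ :=
  ∏ i, eta (cellScale m * x i - n i)

theorem contDiff_cellFun (m : ℤ) (n : Fin d → ℤ) : ContDiff ℝ (⊤ : ℕ∞) (cellFun m n) := by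
  refine contDiff_prod fun i _ => contDiff_eta.comp ?_
  fun_prop

/-- The support of `cellFun m n`. -/
def cell (m : ℤ) (n : Fin d → ℤ) : Set (Space d) :=
  {x | ∀ i, |cellScale m * x i - n i| < 1}

theorem mem_cell_of_cellFun_ne_zero {m : ℤ} {n : Fin d → ℤ} {x : Space d}
    (h : cellFun m n x ≠ 0) : x ∈ cell m n := by
  intro i
  by_contra! hi
  exact h (Finset.prod_eq_zero (Finset.mem_univ i) (eta_eq_zero hi))

theorem cell_eq_preimage (m : ℤ) (n : Fin d → ℤ) :
    cell m n = (MeasurableEquiv.toLp 2 (Fin d → ℝ)).symm ⁻¹' Set.pi Set.univ fun i =>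
      Set.Ioo ((n i - 1) / cellScale m : ℝ) ((n i + 1) / cellScale m) := by
  have hL : (0 : ℝ) < cellScale m := lt_of_lt_of_le two_pos (two_le_cellScale m)
  ext x
  simp only [cell, Set.mem_ofPred_eq, Set.mem_preimage, Set.mem_pi, Set.mem_univ, forall_const,
    Set.mem_Ioo, div_lt_iff₀ hL, lt_div_iff₀ hL, abs_lt]
  refine forall_congr' fun i => ?_
  change _ ↔ (_ < x i * _ ∧ x i * _ < _)
  constructor <;> rintro ⟨h1, h2⟩ <;> constructor <;> linarith

theorem measurableSet_cell (m : ℤ) (n : Fin d → ℤ) : MeasurableSet (cell m n) := by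
  rw [cell_eq_preimage]
  exact (MeasurableEquiv.measurable _) (MeasurableSet.univ_pi fun i => measurableSet_Ioo)

/-- The side `2 / cellScale m` is at most one, so its `d`-th power is at most the side itself. One
scale thus serves all dimensions. -/
theorem volume_cell_le (hd : 1 ≤ d) (m : ℤ) (n : Fin d → ℤ) :
    volume (cell m n) ≤ ENNReal.ofReal (2 / cellScale m) := by
  have hL : (0 : ℝ) < cellScale m := lt_of_lt_of_le two_pos (two_le_cellScale m)
  rw [cell_eq_preimage, (EuclideanSpace.volume_preserving_symm_measurableEquiv_toLp
    (Fin d)).measure_preimage (MeasurableSet.univ_pi fun i => measurableSet_Ioo).nullMeasurableSet,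
    Real.volume_pi_Ioo]
  have h1 : ∀ i : Fin d, ENNReal.ofReal ((n i + 1) / cellScale m - (n i - 1) / cellScale m : ℝ)
      = ENNReal.ofReal (2 / cellScale m) := fun i => by
    congr 1
    field_simp
    ring
  rw [Finset.prod_congr rfl fun i _ => h1 i, Finset.prod_const, Finset.card_univ, Fintype.card_fin]
  refine pow_le_of_le_one zero_le ?_ (by omega)
  rw [ENNReal.ofReal_le_one, div_le_one hL]
  exact two_le_cellScale m

theorem hasCompactSupport_cellFun (m : ℤ) (n : Fin d → ℤ) : HasCompactSupport (cellFun m n) := by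
  have hL : (0 : ℝ) < cellScale m := lt_of_lt_of_le two_pos (two_le_cellScale m)
  set K : Set (Space d) := (EuclideanSpace.equiv (Fin d) ℝ).toHomeomorph ⁻¹' Set.pi Set.univ
    fun i => Set.Icc ((n i - 1) / cellScale m : ℝ) ((n i + 1) / cellScale m) with hK
  refine HasCompactSupport.of_support_subset_isCompact (K := K) ?_ fun x hx => ?_
  · exact (Homeomorph.isCompact_preimage _).2 (isCompact_univ_pi fun i => isCompact_Icc)
  · have h := mem_cell_of_cellFun_ne_zero hx
    rw [cell_eq_preimage] at h
    exact fun i hi => Set.Ioo_subset_Icc_self (h i hi)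

theorem tsum_enorm_cellFun_sq (m : ℤ) (x : Space d) :
    ∑' n : Fin d → ℤ, ‖cellFun m n x‖ₑ ^ 2 = 1 := by
  have h1 : ∀ n : Fin d → ℤ, ‖cellFun m n x‖ₑ ^ 2
      = ∏ i, (fun s => ‖eta s‖ₑ ^ 2) (cellScale m * x i - n i) := fun n => by
    rw [cellFun, enorm_finsetProd, Finset.prod_pow]
  simp only [h1]
  rw [tsum_prod_translates (h := fun _ s => ‖eta s‖ₑ ^ 2) (fun _ => enorm_eta_sq_eq_zero)
    fun i => cellScale m * x i]
  exact Finset.prod_eq_one fun i _ =>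
    enorm_eta_sq_add (Int.fract_nonneg _) (Int.fract_lt_one _).le

theorem fderiv_cellFun_apply (m : ℤ) (n : Fin d → ℤ) (x : Space d) (j : Fin d) :
    fderiv ℝ (cellFun m n) x (basisVec j) = cellScale m *
      ∏ i, (if i = j then deriv eta else eta) (cellScale m * x i - n i) := by
  have h1 : ∀ i, HasFDerivAt (fun x : Space d => eta (cellScale m * x i - n i))
      (deriv eta (cellScale m * x i - n i) • ((cellScale m : ℝ) •
        (EuclideanSpace.proj i : Space d →L[ℝ] ℝ))) x := fun i =>
    HasDerivAt.comp_hasFDerivAt (h₂ := eta) (f := fun x : Space d => cellScale m * x i - n i) x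
      (contDiff_eta.differentiable (by simp) (cellScale m * x i - n i)).hasDerivAt
      (((EuclideanSpace.proj i : Space d →L[ℝ] ℝ).hasFDerivAt.const_mul (cellScale m : ℝ)).sub_const
        (n i : ℝ))
  have h2 := HasFDerivAt.finsetProd (u := Finset.univ) fun i _ => h1 i
  have h3 : fderiv ℝ (cellFun m n) x = _ := h2.fderiv
  rw [h3]
  simp only [FunLike.coe_sum, Finset.sum_apply, smul_apply, smul_eq_mul]
  rw [Finset.sum_eq_single j]
  · rw [← Finset.mul_prod_erase _ _ (Finset.mem_univ j)]
    have h4 : ∏ i ∈ Finset.univ.erase j,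
        (if i = j then deriv eta else eta) (cellScale m * x i - n i)
        = ∏ i ∈ Finset.univ.erase j, eta (cellScale m * x i - n i) :=
      Finset.prod_congr rfl fun i hi => by rw [if_neg (Finset.ne_of_mem_erase hi)]
    rw [h4, if_pos rfl]
    simp
    ring
  · intro i _ hij
    simp [hij]
  · simp

/-- Only the factor of index `j` is differentiated, giving `cellScale m` times a bounded function;
the squares of the other factors still sum to one. -/
theorem exists_tsum_enorm_fderiv_cellFun_sq_le (j : Fin d) :
    ∃ C : ℝ≥0∞, C ≠ ∞ ∧ ∀ (m : ℤ) (x : Space d),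
      ∑' n : Fin d → ℤ, ‖fderiv ℝ (cellFun m n) x (basisVec j)‖ₑ ^ 2
        ≤ ‖(cellScale m : ℝ)‖ₑ ^ 2 * C := by
  obtain ⟨M, hM, hMb⟩ := exists_deriv_eta_bound
  refine ⟨M + M, by finiteness, fun m x => ?_⟩
  have h1 : ∀ n : Fin d → ℤ, ‖fderiv ℝ (cellFun m n) x (basisVec j)‖ₑ ^ 2
      = ‖(cellScale m : ℝ)‖ₑ ^ 2 * ∏ i, (fun (i : Fin d) s =>
        ‖(if i = j then deriv eta else eta) s‖ₑ ^ 2) i (cellScale m * x i - n i) := fun n => by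
    rw [fderiv_cellFun_apply, enorm_mul, mul_pow, enorm_finsetProd, Finset.prod_pow]
  simp only [h1]
  rw [ENNReal.tsum_mul_left, tsum_prod_translates (h := fun (i : Fin d) s =>
    ‖(if i = j then deriv eta else eta) s‖ₑ ^ 2) _ fun i => cellScale m * x i]
  · gcongr
    rw [← Finset.mul_prod_erase _ _ (Finset.mem_univ j)]
    have h2 : ∏ i ∈ Finset.univ.erase j,
        (‖(if i = j then deriv eta else eta) (Int.fract (cellScale m * x i))‖ₑ ^ 2
          + ‖(if i = j then deriv eta else eta) (Int.fract (cellScale m * x i) - 1)‖ₑ ^ 2) = 1 :=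
      Finset.prod_eq_one fun i hi => by
        rw [if_neg (Finset.ne_of_mem_erase hi)]
        exact enorm_eta_sq_add (Int.fract_nonneg _) (Int.fract_lt_one _).le
    rw [h2, mul_one, if_pos rfl]
    gcongr <;> exact hMb _
  · intro i s hs
    by_cases hi : i = j
    · rw [if_pos hi, deriv_eta_eq_zero hs]
      simp
    · rw [if_neg hi, eta_eq_zero hs]
      simp

/-- As the scale is an integer, a lattice translation maps cells of level `m` to cells of level `m`.
Ergodicity of `γ` rests on this. -/
theorem cellFun_add_latticeVec (m : ℤ) (n k : Fin d → ℤ) (x : Space d) :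
    cellFun m (n + (cellScale m : ℤ) • k) (x + latticeVec k) = cellFun m n x := by
  refine Finset.prod_congr rfl fun i _ => ?_
  congr 1
  simp only [PiLp.add_apply, latticeVec, Pi.add_apply, Pi.smul_apply, smul_eq_mul]
  push_cast
  ring

theorem fderiv_cellFun_add_latticeVec (m : ℤ) (n k : Fin d → ℤ) (x : Space d) :
    fderiv ℝ (cellFun m (n + (cellScale m : ℤ) • k)) (x + latticeVec k)
      = fderiv ℝ (cellFun m n) x := by
  rw [← fderiv_comp_add_right]
  congr 1
  ext y
  exact cellFun_add_latticeVec m n k y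

end Partition

/-! ### Multiplication operators and mass in balls -/

section Localization

variable {d : ℕ}

theorem enorm_sq_eq_lintegral (φ : L2 d) : ‖φ‖ₑ ^ 2 = ∫⁻ x, ‖φ x‖ₑ ^ 2 := by
  rw [Lp.enorm_def, eLpNorm_eq_lintegral_rpow_enorm_toReal (by norm_num) (by norm_num)]
  simp only [ENNReal.toReal_ofNat, ENNReal.rpow_ofNat, one_div]
  rw [← ENNReal.rpow_natCast, ← ENNReal.rpow_mul]
  norm_num

theorem memLp_two_iff {f : Space d → ℝ} (hf : AEStronglyMeasurable f) {μ : Measure (Space d)}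
    (hμ : μ ≪ volume) : MemLp f 2 μ ↔ ∫⁻ x, ‖f x‖ₑ ^ 2 ∂μ < ∞ := by
  rw [MemLp, and_iff_right (hf.mono_ac hμ),
    eLpNorm_lt_top_iff_lintegral_rpow_enorm_lt_top (by norm_num) (by norm_num)]
  simp

theorem coeFn_mulOp (χ : LInf d) (φ : L2 d) : mulOp χ φ =ᵐ[volume] fun x => χ x * φ x :=
  ContinuousLinearMap.coeFn_holder (r := 2) (ContinuousLinearMap.mul ℂ ℂ) χ φ

theorem inner_mulOp_right (χ : LInf d) (φ ψ : L2 d) :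
    ⟪φ, mulOp χ ψ⟫_ℂ = ⟪mulOp (star χ) φ, ψ⟫_ℂ := by
  rw [inner_eq_integral_of_ae_eq (ae_eq_refl φ) (coeFn_mulOp χ ψ),
    inner_eq_integral_of_ae_eq (coeFn_mulOp (star χ) φ) (ae_eq_refl ψ)]
  refine integral_congr_ae ?_
  filter_upwards [Lp.coeFn_star χ] with x hx
  rw [hx, Pi.star_apply, map_mul, RCLike.star_def, RCLike.conj_conj]
  ring

/-- The `L²` mass of a function in a ball centered at the origin. -/
noncomputable def ballMass {F : Type*} [NormedAddCommGroup F] (R : ℝ) (f : Space d → F) : ℝ≥0∞ :=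
  ∫⁻ x in Metric.closedBall 0 R, ‖f x‖ₑ ^ 2

theorem ballMass_congr {F G : Type*} [NormedAddCommGroup F] [NormedAddCommGroup G] {R : ℝ}
    {f : Space d → F} {g : Space d → G} (h : ∀ᵐ x, ‖f x‖ₑ = ‖g x‖ₑ) :
    ballMass R f = ballMass R g :=
  lintegral_congr_ae (ae_restrict_of_ae (h.mono fun x hx => by simp only [hx]))

theorem ballMass_mono {F : Type*} [NormedAddCommGroup F] {R S : ℝ} (h : R ≤ S)
    (f : Space d → F) : ballMass R f ≤ ballMass S f :=
  lintegral_mono_set (Metric.closedBall_subset_closedBall h)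

theorem eLpNormEssSup_lt_top_of_LInf (χ : LInf d) : eLpNormEssSup χ volume < ∞ := by
  have := (Lp.memLp χ).2
  rwa [eLpNorm_exponent_top] at this

theorem enorm_mulOp_sq_le {χ : LInf d} {R : ℝ} (hχ : ∀ᵐ x, R < ‖x‖ → χ x = 0) (φ : L2 d) :
    ‖mulOp χ φ‖ₑ ^ 2 ≤ eLpNormEssSup χ volume ^ 2 * ballMass R φ := by
  rw [enorm_sq_eq_lintegral, ballMass,
    ← lintegral_const_mul' _ _ (ENNReal.pow_lt_top (eLpNormEssSup_lt_top_of_LInf χ)).ne,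
    ← lintegral_indicator Metric.isClosed_closedBall.measurableSet]
  refine lintegral_mono_ae ?_
  filter_upwards [coeFn_mulOp χ φ, hχ, enorm_ae_le_eLpNormEssSup χ volume] with x h1 h2 h3
  rw [h1]
  by_cases hx : x ∈ Metric.closedBall (0 : Space d) R
  · rw [Set.indicator_of_mem hx, enorm_mul, mul_pow]
    gcongr
  · rw [mem_closedBall_zero_iff, not_le] at hx
    rw [h2 hx]
    simp

theorem enorm_inner_le (φ ψ : L2 d) : ‖⟪φ, ψ⟫_ℂ‖ₑ ≤ ‖φ‖ₑ * ‖ψ‖ₑ := by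
  rw [← ofReal_norm, ← ofReal_norm, ← ofReal_norm, ← ENNReal.ofReal_mul (norm_nonneg _)]
  exact ENNReal.ofReal_le_ofReal (norm_inner_le_norm _ _)

theorem enorm_inner_sq_le_ballMass {φ : L2 d} {R : ℝ} (hφ : ∀ᵐ x, R < ‖x‖ → φ x = 0) (ψ : L2 d) :
    ‖⟪φ, ψ⟫_ℂ‖ₑ ^ 2 ≤ ‖φ‖ₑ ^ 2 * ballMass R ψ := by
  set s : Set (Space d) := Metric.closedBall 0 R with hs_def
  have hs : MeasurableSet s := Metric.isClosed_closedBall.measurableSet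
  have hmem : MemLp (s.indicator ψ) 2 volume := (Lp.memLp ψ).indicator hs
  have h1 : ⟪φ, ψ⟫_ℂ = ⟪φ, hmem.toLp _⟫_ℂ := by
    rw [inner_eq_integral_of_ae_eq (ae_eq_refl φ) (ae_eq_refl ψ),
      inner_eq_integral_of_ae_eq (ae_eq_refl φ) hmem.coeFn_toLp]
    refine integral_congr_ae ?_
    filter_upwards [hφ] with x hx
    by_cases h : x ∈ s
    · rw [Set.indicator_of_mem h]
    · rw [hs_def, mem_closedBall_zero_iff, not_le] at h
      simp [hx h]
  have h2 : ‖hmem.toLp _‖ₑ ^ 2 = ballMass R ψ := by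
    rw [enorm_sq_eq_lintegral, ballMass, ← lintegral_indicator hs]
    refine lintegral_congr_ae ?_
    filter_upwards [hmem.coeFn_toLp] with x hx
    rw [hx]
    by_cases h : x ∈ s
    · rw [Set.indicator_of_mem h, Set.indicator_of_mem h]
    · rw [Set.indicator_of_notMem h, Set.indicator_of_notMem h]
      simp
  rw [h1, ← h2, ← mul_pow]
  gcongr
  exact enorm_inner_le _ _

/-- The element of `L²(ℝᵈ, ℂ)` given by a real function. -/
noncomputable def toL2 {f : Space d → ℝ} (hf : MemLp f 2 volume) : L2 d := hf.ofReal.toLp _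

theorem coeFn_toL2 {f : Space d → ℝ} (hf : MemLp f 2 volume) :
    toL2 hf =ᵐ[volume] fun x => (f x : ℂ) := MemLp.coeFn_toLp _

theorem ballMass_toL2 {f : Space d → ℝ} (hf : MemLp f 2 volume) (R : ℝ) :
    ballMass R (toL2 hf) = ballMass R f :=
  ballMass_congr ((coeFn_toL2 hf).mono fun x hx => by
    rw [hx]; simp [enorm_eq_nnnorm])

theorem toL2_eq_shift {f g : Space d → ℝ} (hf : MemLp f 2 volume) (hg : MemLp g 2 volume)
    {a : Space d} (h : ∀ᵐ x, f x = g (x + a)) : toL2 hf = shift a (toL2 hg) := by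
  refine Lp.ext ?_
  filter_upwards [coeFn_toL2 hf, coeFn_shift a (toL2 hg), ae_comp_add_right (coeFn_toL2 hg) a, h]
    with x h1 h2 h3 h4
  rw [h1, h2, h3, h4]

theorem translation_apply (k : Fin d → ℤ) (φ : L2 d) : translation k φ = shift (latticeVec k) φ :=
  rfl

end Localization

/-! ### Random families of functions and their local trace class forms -/

section RandomFamilies

variable {Ω : Type*} [MeasurableSpace Ω] {d : ℕ} {A : Type*}

theorem measurable_of_hasSum [Countable A] {g : A → Ω → ℂ} {G : Ω → ℂ}
    (hg : ∀ α, Measurable (g α)) (h : ∀ ω, HasSum (fun α => g α ω) (G ω)) : Measurable G := by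
  refine measurable_of_tendsto_metrizable' (atTop : Filter (Finset A))
    (f := fun s ω => ∑ α ∈ s, g α ω) (fun s => Finset.measurable_sum s fun α _ => hg α) ?_
  exact tendsto_pi_nhds.2 fun ω => h ω

/-- A countable family of random functions which are square integrable, and whose squares are
locally summable in expectation. -/
structure IsLocalFamily (P : Measure Ω) (f : A → Ω → Space d → ℝ) : Prop where
  measurable : ∀ α, Measurable (Function.uncurry (f α))
  memLp : ∀ α ω, MemLp (f α ω) 2 volume
  lintegral_lt_top : ∀ R, ∫⁻ ω, ∑' α, ballMass R (f α ω) ∂P < ∞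

variable {P : Measure Ω} {f : A → Ω → Space d → ℝ}

theorem measurable_ballMass {f : Ω → Space d → ℝ} (hf : Measurable (Function.uncurry f)) (R : ℝ) :
    Measurable fun ω => ballMass R (f ω) :=
  Measurable.lintegral_prod_right' (f := fun p : Ω × Space d => ‖f p.1 p.2‖ₑ ^ 2)
    (hf.enorm.pow_const 2)

theorem measurable_inner_toL2 {f : Ω → Space d → ℝ} (hf : Measurable (Function.uncurry f))
    (hL : ∀ ω, MemLp (f ω) 2 volume) (φ : L2 d) : Measurable fun ω => ⟪φ, toL2 (hL ω)⟫_ℂ := by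
  have h1 : ∀ ω, ⟪φ, toL2 (hL ω)⟫_ℂ = ∫ x, (starRingEnd ℂ) (φ x) * (f ω x : ℂ) := fun ω =>
    inner_eq_integral_of_ae_eq (ae_eq_refl φ) (coeFn_toL2 (hL ω))
  simp only [h1]
  have h2 : StronglyMeasurable fun p : Ω × Space d =>
      (starRingEnd ℂ) (φ p.2) * ((Function.uncurry f p : ℝ) : ℂ) := by
    have h3 : Measurable fun x => φ x := (Lp.stronglyMeasurable φ).measurable
    exact ((Complex.continuous_conj.measurable.comp (h3.comp measurable_snd)).mul
      (Complex.measurable_ofReal.comp hf)).stronglyMeasurable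
  exact (StronglyMeasurable.integral_prod_right h2).measurable

theorem measurable_inner_toL2_left {f : Ω → Space d → ℝ} (hf : Measurable (Function.uncurry f))
    (hL : ∀ ω, MemLp (f ω) 2 volume) (φ : L2 d) : Measurable fun ω => ⟪toL2 (hL ω), φ⟫_ℂ := by
  simp only [← inner_conj_symm _ φ]
  exact Complex.continuous_conj.measurable.comp (measurable_inner_toL2 hf hL φ)

theorem tsum_enorm_mulOp_sq_le {χ : LInf d} {R : ℝ} (hχ : ∀ᵐ x, R < ‖x‖ → χ x = 0)
    {f : A → Space d → ℝ} (hf : ∀ α, MemLp (f α) 2 volume) :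
    ∑' α, (‖mulOp χ (toL2 (hf α))‖ₑ ^ 2 + ‖mulOp (star χ) (toL2 (hf α))‖ₑ ^ 2)
      ≤ (eLpNormEssSup χ volume ^ 2 + eLpNormEssSup (star χ : LInf d) volume ^ 2)
        * ∑' α, ballMass R (f α) := by
  have hχ' : ∀ᵐ x, R < ‖x‖ → (star χ : LInf d) x = 0 := by
    filter_upwards [hχ, Lp.coeFn_star χ] with x h1 h2 hx
    rw [h2, Pi.star_apply, h1 hx, star_zero]
  rw [← ENNReal.tsum_mul_left]
  refine ENNReal.tsum_le_tsum fun α => ?_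
  rw [add_mul, ← ballMass_toL2 (hf α)]
  exact add_le_add (enorm_mulOp_sq_le hχ _) (enorm_mulOp_sq_le hχ' _)

theorem essSup_coeff_ne_top (χ : LInf d) :
    eLpNormEssSup χ volume ^ 2 + eLpNormEssSup (star χ : LInf d) volume ^ 2 ≠ ∞ := by
  have h1 := eLpNormEssSup_lt_top_of_LInf χ
  have h2 := eLpNormEssSup_lt_top_of_LInf (star χ)
  exact ENNReal.add_ne_top.2 ⟨(ENNReal.pow_lt_top h1).ne, (ENNReal.pow_lt_top h2).ne⟩

/-- Matrix elements are limits of measurable partial sums, and `traceNorm_le_of_hasSum` bounds the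
trace norm by the mass of the family in a ball containing the support of `χ`. -/
theorem IsLocalFamily.memL1TraceClass [Countable A] (hf : IsLocalFamily P f) {χ : LInf d}
    (hχ : CompactlySupported χ) {T : Ω → (L2 d →L[ℂ] L2 d)}
    (hT : ∀ ω φ ψ, HasSum (fun α => ⟪φ, mulOp χ (toL2 (hf.memLp α ω))⟫_ℂ *
      ⟪mulOp (star χ) (toL2 (hf.memLp α ω)), ψ⟫_ℂ) ⟪φ, T ω ψ⟫_ℂ) :
    MemL1TraceClass P T where
  random φ ψ := by
    refine measurable_of_hasSum (fun α => ?_) fun ω => hT ω φ ψ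
    simp only [inner_mulOp_right χ φ, ← inner_mulOp_right χ _ ψ]
    have h1 := measurable_inner_toL2 (hf.measurable α) (hf.memLp α) (mulOp (star χ) φ)
    have h2 := measurable_inner_toL2_left (hf.measurable α) (hf.memLp α) (mulOp χ ψ)
    exact h1.mul h2
  lintegral_lt_top := by
    obtain ⟨R, hR⟩ := hχ
    refine lt_of_le_of_lt (lintegral_mono fun ω => (traceNorm_le_of_hasSum (hT ω)).trans
      (tsum_enorm_mulOp_sq_le hR fun α => hf.memLp α ω)) ?_
    rw [lintegral_const_mul' _ _ (essSup_coeff_ne_top χ)]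
    exact ENNReal.mul_lt_top (essSup_coeff_ne_top χ).lt_top (hf.lintegral_lt_top R)

theorem summable_inner_mul_inner {v : A → L2 d} (hv : ∀ R, ∑' α, ballMass R (v α) < ∞)
    {φ ψ : L2 d} (hφ : φ ∈ L2c d) (hψ : ψ ∈ L2c d) :
    Summable fun α => ⟪φ, v α⟫_ℂ * ⟪v α, ψ⟫_ℂ := by
  obtain ⟨R, hR⟩ := hφ
  obtain ⟨S, hS⟩ := hψ
  have h1 : ∀ α, ‖⟪φ, v α⟫_ℂ * ⟪v α, ψ⟫_ℂ‖ₑ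
      ≤ ‖φ‖ₑ ^ 2 * ballMass R (v α) + ‖ψ‖ₑ ^ 2 * ballMass S (v α) := fun α => by
    refine (enorm_mul_le_add_sq _ _).trans (add_le_add (enorm_inner_sq_le_ballMass hR (v α)) ?_)
    rw [← inner_conj_symm, RCLike.enorm_conj]
    exact enorm_inner_sq_le_ballMass hS (v α)
  refine summable_of_tsum_enorm_lt_top (lt_of_le_of_lt (ENNReal.tsum_le_tsum h1) ?_)
  rw [ENNReal.tsum_add, ENNReal.tsum_mul_left, ENNReal.tsum_mul_left]
  exact ENNReal.add_lt_top.2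
    ⟨ENNReal.mul_lt_top (ENNReal.pow_lt_top enorm_lt_top) (hv R),
      ENNReal.mul_lt_top (ENNReal.pow_lt_top enorm_lt_top) (hv S)⟩

/-- The form `∑ |v⟩⟨v|` on `L²_c(ℝᵈ)` of a locally square summable family. -/
noncomputable def sumForm (v : A → L2 d) (hv : ∀ R, ∑' α, ballMass R (v α) < ∞) : LocalForm d :=
  LinearMap.mk₂'ₛₗ (starRingEnd ℂ) (RingHom.id ℂ)
    (fun φ ψ : L2c d => ∑' α, ⟪(φ : L2 d), v α⟫_ℂ * ⟪v α, (ψ : L2 d)⟫_ℂ)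
    (fun φ φ' ψ => by
      rw [← (summable_inner_mul_inner hv φ.2 ψ.2).tsum_add
        (summable_inner_mul_inner hv φ'.2 ψ.2)]
      simp only [Submodule.coe_add, inner_add_left, add_mul])
    (fun c φ ψ => by
      rw [smul_eq_mul, ← tsum_mul_left]
      simp only [Submodule.coe_smul, inner_smul_left, mul_assoc])
    (fun φ ψ ψ' => by
      rw [← (summable_inner_mul_inner hv φ.2 ψ.2).tsum_add
        (summable_inner_mul_inner hv φ.2 ψ'.2)]
      simp only [Submodule.coe_add, inner_add_right, mul_add])
    (fun c φ ψ => by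
      rw [RingHom.id_apply, smul_eq_mul, ← tsum_mul_left]
      simp only [Submodule.coe_smul, inner_smul_right, mul_left_comm])

theorem sumForm_apply (v : A → L2 d) (hv : ∀ R, ∑' α, ballMass R (v α) < ∞) (φ ψ : L2c d) :
    sumForm v hv φ ψ = ∑' α, ⟪(φ : L2 d), v α⟫_ℂ * ⟪v α, (ψ : L2 d)⟫_ℂ := rfl

theorem IsLocalFamily.ae_lt_top [Countable A] (hf : IsLocalFamily P f) :
    ∀ᵐ ω ∂P, ∀ R, ∑' α, ballMass R (f α ω) < ∞ := by
  have h1 : ∀ᵐ ω ∂P, ∀ n : ℕ, ∑' α, ballMass (n : ℝ) (f α ω) < ∞ :=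
    ae_all_iff.2 fun n => MeasureTheory.ae_lt_top
      (Measurable.tsum fun α => measurable_ballMass (hf.measurable α) _)
      (hf.lintegral_lt_top n).ne
  filter_upwards [h1] with ω h R
  obtain ⟨n, hn⟩ := exists_nat_ge R
  exact lt_of_le_of_lt (ENNReal.tsum_le_tsum fun α => ballMass_mono hn _) (h n)

end RandomFamilies

/-! ### The orbitals: Bessel's inequality and the sum of squared derivatives -/

section Orbitals

variable {d : ℕ} {u g : Space d → ℝ}

/-- The orbitals whose squares sum up to `u²`. -/
noncomputable def orbital (u : Space d → ℝ) (α : ℤ × (Fin d → ℤ)) (x : Space d) : ℝ :=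
  cellFun α.1 α.2 x * level α.1 (u x)

/-- The derivatives of the orbitals in the direction `j`, where `g` is that of `u`. -/
noncomputable def orbitalDeriv (j : Fin d) (u g : Space d → ℝ) (α : ℤ × (Fin d → ℤ))
    (x : Space d) : ℝ :=
  cellFun α.1 α.2 x * (deriv (level α.1) (u x) * g x)
    + fderiv ℝ (cellFun α.1 α.2) x (basisVec j) * level α.1 (u x)

theorem continuous_level (m : ℤ) : Continuous (level m) := (contDiff_level m).continuous

theorem continuous_deriv_level (m : ℤ) : Continuous (deriv (level m)) :=
  (contDiff_level m).continuous_deriv (by simp)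

theorem continuous_cellFun (m : ℤ) (n : Fin d → ℤ) : Continuous (cellFun m n) :=
  (contDiff_cellFun m n).continuous

theorem continuous_fderiv_cellFun (m : ℤ) (n : Fin d → ℤ) (j : Fin d) :
    Continuous fun x => fderiv ℝ (cellFun m n) x (basisVec j) :=
  ((contDiff_cellFun m n).continuous_fderiv (by simp)).clm_apply continuous_const

theorem memLp_orbital (hu : Measurable u) (α : ℤ × (Fin d → ℤ)) :
    MemLp (orbital u α) 2 volume := by
  refine ((continuous_cellFun α.1 α.2).memLp_of_hasCompactSupport
    (hasCompactSupport_cellFun α.1 α.2)).of_le_mul (c := Real.exp (α.1 + 1)) ?_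
    (.of_forall fun x => ?_)
  · exact ((continuous_cellFun _ _).measurable.mul
      ((continuous_level _).measurable.comp hu)).aestronglyMeasurable
  · rw [orbital, norm_mul, mul_comm]
    exact mul_le_mul_of_nonneg_right (abs_level_le _ _) (norm_nonneg _)

theorem tsum_enorm_orbital_sq (u : Space d → ℝ) (x : Space d) :
    ∑' α, ‖orbital u α x‖ₑ ^ 2 = ‖u x‖ₑ ^ 2 := by
  rw [ENNReal.tsum_prod']
  simp only [orbital, enorm_mul, mul_pow, ENNReal.tsum_mul_right, tsum_enorm_cellFun_sq, one_mul,
    tsum_enorm_level_sq]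

theorem hasSum_orbital_sq (u : Space d → ℝ) (x : Space d) :
    HasSum (fun α => orbital u α x ^ 2) (u x ^ 2) := by
  have h1 := tsum_enorm_orbital_sq u x
  simp only [enorm_sq_eq_ofReal] at h1
  have h2 : Summable fun α => (ENNReal.ofReal (orbital u α x ^ 2)).toReal :=
    ENNReal.summable_toReal (by rw [h1]; exact ENNReal.ofReal_ne_top)
  simp only [ENNReal.toReal_ofReal (sq_nonneg _)] at h2
  rw [← ENNReal.ofReal_tsum_of_nonneg (fun _ => sq_nonneg _) h2] at h1
  rw [← (ENNReal.ofReal_eq_ofReal_iff (tsum_nonneg fun _ => sq_nonneg _) (sq_nonneg _)).1 h1]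
  exact h2.hasSum

theorem lintegral_mul_sq_le {f h : Space d → ℝ≥0∞} (hf : AEMeasurable f) (hh : AEMeasurable h) :
    (∫⁻ x, f x * h x) ^ 2 ≤ (∫⁻ x, f x ^ 2) * ∫⁻ x, h x ^ 2 := by
  have h1 := ENNReal.lintegral_mul_le_Lp_mul_Lq volume Real.HolderConjugate.two_two hf hh
  simp only [ENNReal.rpow_ofNat, Pi.mul_apply] at h1
  calc (∫⁻ x, f x * h x) ^ 2
      ≤ ((∫⁻ x, f x ^ 2) ^ (1 / 2 : ℝ) * (∫⁻ x, h x ^ 2) ^ (1 / 2 : ℝ)) ^ 2 := by gcongr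
    _ = _ := by
      rw [mul_pow, ← ENNReal.rpow_natCast, ← ENNReal.rpow_mul, ← ENNReal.rpow_natCast,
        ← ENNReal.rpow_mul]
      norm_num

/-- The mass of the `m`-th level in one cell is at most one. -/
theorem lintegral_level_support_cell_le (hd : 1 ≤ d) (u : Space d → ℝ) (m : ℤ) (n : Fin d → ℤ) :
    ∫⁻ x, ({x | x ∈ cell m n ∧ level m (u x) ≠ 0}.indicator (fun x => ‖u x‖ₑ) x) ^ 2 ≤ 1 := by
  have hL : (0 : ℝ) < cellScale m := lt_of_lt_of_le two_pos (two_le_cellScale m)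
  calc ∫⁻ x, ({x | x ∈ cell m n ∧ level m (u x) ≠ 0}.indicator (fun x => ‖u x‖ₑ) x) ^ 2
      ≤ ∫⁻ x, (cell m n).indicator (fun _ => ENNReal.ofReal (Real.exp (m + 1) ^ 2)) x := by
        refine lintegral_mono fun x => ?_
        by_cases hx : x ∈ cell m n ∧ level m (u x) ≠ 0
        · rw [Set.indicator_of_mem (show x ∈ {x | x ∈ cell m n ∧ level m (u x) ≠ 0} from hx),
            Set.indicator_of_mem hx.1, enorm_sq_eq_ofReal]
          refine ENNReal.ofReal_le_ofReal ?_
          rw [← sq_abs]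
          exact pow_le_pow_left₀ (abs_nonneg _) (exp_lt_abs_lt_exp_of_level_ne_zero hx.2).2.le 2
        · rw [Set.indicator_of_notMem (show x ∉ {x | x ∈ cell m n ∧ level m (u x) ≠ 0} from hx)]
          simp
    _ = ENNReal.ofReal (Real.exp (m + 1) ^ 2) * volume (cell m n) := by
        rw [lintegral_indicator_const (measurableSet_cell m n)]
    _ ≤ ENNReal.ofReal (Real.exp (m + 1) ^ 2) * ENNReal.ofReal (2 / cellScale m) := by
        gcongr
        exact volume_cell_le hd m n
    _ ≤ 1 := by
        rw [← ENNReal.ofReal_mul (by positivity), ENNReal.ofReal_le_one, mul_div_assoc',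
          div_le_one hL, mul_comm]
        refine le_trans (le_of_eq ?_) (two_mul_exp_le_cellScale m)
        rw [← Real.exp_nat_mul]
        congr 2
        push_cast
        ring

/-- Each orbital is `u` times a weight `w α`. Cauchy–Schwarz puts `u`, restricted to the cell and
level, in one factor, which is at most one, and `w α φ` in the other; the squares of the weights sum
to one. -/
theorem bessel_orbital (hd : 1 ≤ d) (hu : Measurable u) (φ : L2 d) :
    ∑' α, ‖⟪toL2 (memLp_orbital hu α), φ⟫_ℂ‖ₑ ^ 2 ≤ ‖φ‖ₑ ^ 2 := by
  set w : ℤ × (Fin d → ℤ) → Space d → ℝ := fun α x =>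
    cellFun α.1 α.2 x * eta (Real.log (u x) - α.1) with hw
  have hwm : ∀ α, Measurable (w α) := fun α =>
    (continuous_cellFun _ _).measurable.mul
      (contDiff_eta.continuous.measurable.comp ((Real.measurable_log.comp hu).sub_const _))
  have hφm : Measurable φ := (Lp.stronglyMeasurable φ).measurable
  -- This holds also where `u` vanishes, since there `Real.log` takes the value `0`.
  have hw1 : ∀ x, ∑' α, ‖w α x‖ₑ ^ 2 = 1 := fun x => by
    rw [ENNReal.tsum_prod']
    simp only [hw, enorm_mul, mul_pow, ENNReal.tsum_mul_right, tsum_enorm_cellFun_sq, one_mul,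
      tsum_enorm_eta_sq]
  have hle : ∀ α, ‖⟪toL2 (memLp_orbital hu α), φ⟫_ℂ‖ₑ ^ 2
      ≤ ∫⁻ x, ‖w α x‖ₑ ^ 2 * ‖φ x‖ₑ ^ 2 := by
    rintro ⟨m, n⟩
    have hS : MeasurableSet {x | x ∈ cell m n ∧ level m (u x) ≠ 0} :=
      (measurableSet_cell m n).inter
        (((continuous_level m).measurable.comp hu) (measurableSet_singleton 0).compl)
    rw [inner_eq_integral_of_ae_eq (coeFn_toL2 _) (ae_eq_refl φ)]
    calc ‖∫ x, (starRingEnd ℂ) ((orbital u (m, n) x : ℝ) : ℂ) * φ x‖ₑ ^ 2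
        ≤ (∫⁻ x, ({x | x ∈ cell m n ∧ level m (u x) ≠ 0}.indicator (fun x => ‖u x‖ₑ) x)
            * (‖w (m, n) x‖ₑ * ‖φ x‖ₑ)) ^ 2 := by
          gcongr
          refine (enorm_integral_le_lintegral_enorm _).trans (lintegral_mono fun x => ?_)
          rw [Complex.conj_ofReal, enorm_mul, ← mul_assoc]
          gcongr
          have h0 : ‖((orbital u (m, n) x : ℝ) : ℂ)‖ₑ = ‖orbital u (m, n) x‖ₑ := by
            simp [enorm_eq_nnnorm]
          rw [h0]
          by_cases hx : x ∈ cell m n ∧ level m (u x) ≠ 0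
          · rw [Set.indicator_of_mem (show x ∈ {x | x ∈ cell m n ∧ level m (u x) ≠ 0} from hx),
              ← enorm_mul]
            refine le_of_eq (congrArg _ ?_)
            simp only [orbital, hw, level]
            ring
          · have : orbital u (m, n) x = 0 := by
              rw [not_and_or, not_not] at hx
              rcases hx with hx | hx
              · have : cellFun m n x = 0 := by
                  by_contra h
                  exact hx (mem_cell_of_cellFun_ne_zero h)
                rw [orbital, this, zero_mul]
              · rw [orbital, hx, mul_zero]
            rw [this]
            simp
      _ ≤ (∫⁻ x, ({x | x ∈ cell m n ∧ level m (u x) ≠ 0}.indicator (fun x => ‖u x‖ₑ) x) ^ 2)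
            * ∫⁻ x, (‖w (m, n) x‖ₑ * ‖φ x‖ₑ) ^ 2 :=
          lintegral_mul_sq_le (hu.enorm.indicator hS).aemeasurable
            ((hwm _).enorm.mul hφm.enorm).aemeasurable
      _ ≤ 1 * ∫⁻ x, (‖w (m, n) x‖ₑ * ‖φ x‖ₑ) ^ 2 := by
          gcongr
          exact lintegral_level_support_cell_le hd u m n
      _ = _ := by simp only [one_mul, mul_pow]
  calc ∑' α, ‖⟪toL2 (memLp_orbital hu α), φ⟫_ℂ‖ₑ ^ 2
      ≤ ∑' α, ∫⁻ x, ‖w α x‖ₑ ^ 2 * ‖φ x‖ₑ ^ 2 := ENNReal.tsum_le_tsum hle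
    _ = ∫⁻ x, ∑' α, ‖w α x‖ₑ ^ 2 * ‖φ x‖ₑ ^ 2 :=
        (lintegral_tsum fun α =>
          (((hwm α).enorm.pow_const 2).mul (hφm.enorm.pow_const 2)).aemeasurable).symm
    _ = ‖φ‖ₑ ^ 2 := by
        simp only [ENNReal.tsum_mul_right, hw1, one_mul, enorm_sq_eq_lintegral]

theorem hasWeakDeriv_orbital {j : Fin d} (h : HasWeakDeriv j u g) (hu : MemL2Loc u)
    (hg : MemL2Loc g) (α : ℤ × (Fin d → ℤ)) :
    HasWeakDeriv j (orbital u α) (orbitalDeriv j u g α) := by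
  have h1 := (h.comp_contDiff hu hg (contDiff_level α.1) (hasCompactSupport_level α.1)).smul
    (contDiff_cellFun α.1 α.2)
  simp only [smul_eq_mul] at h1
  exact h1

/-- Differentiating the level costs a multiple of `g²`; differentiating the cell function costs
`cellScale² · level²`, and on the support of the level the scale is bounded by a function of `u`
alone. The sum over levels can then be carried out. -/
theorem exists_tsum_enorm_orbitalDeriv_sq_le (j : Fin d) :
    ∃ C : ℝ≥0∞, C ≠ ∞ ∧ ∀ (u g : Space d → ℝ) (x : Space d),
      ∑' α, ‖orbitalDeriv j u g α x‖ₑ ^ 2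
        ≤ C * (‖g x‖ₑ ^ 2 + ‖(2 * Real.exp 4 * u x ^ 2 + 3) * u x‖ₑ ^ 2) := by
  obtain ⟨C₁, hC₁, h₁⟩ := exists_tsum_enorm_deriv_level_sq_le
  obtain ⟨C₂, hC₂, h₂⟩ := exists_tsum_enorm_fderiv_cellFun_sq_le j
  refine ⟨2 * (C₁ + C₂), by finiteness, fun u g x => ?_⟩
  set K : ℝ≥0∞ := ‖2 * Real.exp 4 * u x ^ 2 + 3‖ₑ ^ 2 with hK
  have hlev : ∀ m : ℤ, ‖(cellScale m : ℝ)‖ₑ ^ 2 * ‖level m (u x)‖ₑ ^ 2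
      ≤ K * ‖level m (u x)‖ₑ ^ 2 := by
    intro m
    by_cases hm : level m (u x) = 0
    · simp [hm]
    · gcongr
      rw [hK]
      gcongr
      rw [enorm_le_iff_norm_le, Real.norm_eq_abs, Real.norm_eq_abs, abs_of_nonneg (by positivity),
        abs_of_nonneg (by positivity)]
      exact cellScale_le_of_level_ne_zero hm
  calc ∑' α, ‖orbitalDeriv j u g α x‖ₑ ^ 2
      ≤ ∑' α : ℤ × (Fin d → ℤ), 2 * (‖cellFun α.1 α.2 x‖ₑ ^ 2 * (‖deriv (level α.1) (u x)‖ₑ ^ 2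
          * ‖g x‖ₑ ^ 2) + ‖fderiv ℝ (cellFun α.1 α.2) x (basisVec j)‖ₑ ^ 2
          * ‖level α.1 (u x)‖ₑ ^ 2) := by
        refine ENNReal.tsum_le_tsum fun α => ?_
        rw [orbitalDeriv]
        simp only [← mul_pow, ← enorm_mul]
        exact enorm_add_sq_le _ _
    _ = 2 * (∑' m : ℤ, ‖deriv (level m) (u x)‖ₑ ^ 2 * ‖g x‖ₑ ^ 2 + ∑' m : ℤ,
          (∑' n : Fin d → ℤ, ‖fderiv ℝ (cellFun m n) x (basisVec j)‖ₑ ^ 2)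
          * ‖level m (u x)‖ₑ ^ 2) := by
        rw [ENNReal.tsum_mul_left, ENNReal.tsum_add, ENNReal.tsum_prod', ENNReal.tsum_prod']
        simp only [ENNReal.tsum_mul_right, tsum_enorm_cellFun_sq, one_mul]
    _ ≤ 2 * (C₁ * ‖g x‖ₑ ^ 2 + ∑' m : ℤ, C₂ * (K * ‖level m (u x)‖ₑ ^ 2)) := by
        rw [ENNReal.tsum_mul_right]
        refine mul_le_mul_right (add_le_add (mul_le_mul_left (h₁ _) _)
          (ENNReal.tsum_le_tsum fun m => ?_)) _
        calc _ ≤ (‖(cellScale m : ℝ)‖ₑ ^ 2 * C₂) * ‖level m (u x)‖ₑ ^ 2 :=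
              mul_le_mul_left (h₂ m x) _
          _ = C₂ * (‖(cellScale m : ℝ)‖ₑ ^ 2 * ‖level m (u x)‖ₑ ^ 2) := by ring
          _ ≤ _ := mul_le_mul_right (hlev m) _
    _ = 2 * (C₁ * ‖g x‖ₑ ^ 2 + C₂ * ‖(2 * Real.exp 4 * u x ^ 2 + 3) * u x‖ₑ ^ 2) := by
        rw [ENNReal.tsum_mul_left, ENNReal.tsum_mul_left, tsum_enorm_level_sq, enorm_mul, mul_pow]
    _ ≤ 2 * ((C₁ + C₂) * ‖g x‖ₑ ^ 2
          + (C₁ + C₂) * ‖(2 * Real.exp 4 * u x ^ 2 + 3) * u x‖ₑ ^ 2) := by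
        gcongr
        · exact le_self_add
        · exact le_add_self
    _ = _ := by ring

theorem exists_support_orbitalDeriv_subset (j : Fin d) (α : ℤ × (Fin d → ℤ)) :
    ∃ R : ℝ, ∀ (u g : Space d → ℝ) x, x ∉ Metric.closedBall (0 : Space d) R →
      orbitalDeriv j u g α x = 0 := by
  obtain ⟨R, hR⟩ := (hasCompactSupport_cellFun α.1 α.2).isCompact.isBounded.subset_closedBall 0
  refine ⟨R, fun u g x hx => ?_⟩
  have hx' : x ∉ tsupport (cellFun α.1 α.2) := fun h => hx (hR h)
  have h1 : fderiv ℝ (cellFun α.1 α.2) x = 0 :=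
    image_eq_zero_of_notMem_tsupport fun h => hx' (tsupport_fderiv_subset ℝ h)
  rw [orbitalDeriv, image_eq_zero_of_notMem_tsupport hx', h1]
  simp

theorem measurable_orbitalDeriv (j : Fin d) {Y : Type*} [MeasurableSpace Y] {u g : Y → ℝ}
    (hu : Measurable u) (hg : Measurable g) {p : Y → Space d} (hp : Measurable p)
    (α : ℤ × (Fin d → ℤ)) :
    Measurable fun y => orbitalDeriv j (fun _ => u y) (fun _ => g y) α (p y) :=
  (((continuous_cellFun _ _).measurable.comp hp).mul
    (((continuous_deriv_level _).measurable.comp hu).mul hg)).add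
    (((continuous_fderiv_cellFun _ _ j).measurable.comp hp).mul
      ((continuous_level _).measurable.comp hu))

theorem memLp_orbitalDeriv {j : Fin d} (hu : Measurable u) (hg : Measurable g)
    (h : ∀ R, ∑' α, ballMass R (orbitalDeriv j u g α) < ∞) (α : ℤ × (Fin d → ℤ)) :
    MemLp (orbitalDeriv j u g α) 2 volume := by
  obtain ⟨R, hR⟩ := exists_support_orbitalDeriv_subset j α
  have hm : Measurable (orbitalDeriv j u g α) := measurable_orbitalDeriv j hu hg measurable_id α
  rw [memLp_two_iff hm.aestronglyMeasurable Measure.AbsolutelyContinuous.rfl]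
  refine lt_of_le_of_lt (le_of_eq ?_) (lt_of_le_of_lt (ENNReal.le_tsum α) (h R))
  rw [ballMass, ← lintegral_indicator Metric.isClosed_closedBall.measurableSet]
  refine lintegral_congr fun x => ?_
  by_cases hx : x ∈ Metric.closedBall (0 : Space d) R
  · rw [Set.indicator_of_mem hx]
  · rw [Set.indicator_of_notMem hx, hR u g x hx]
    simp

/-- The action of the lattice on the indices of the orbitals. -/
noncomputable def indexShift (k : Fin d → ℤ) : (ℤ × (Fin d → ℤ)) ≃ (ℤ × (Fin d → ℤ)) where
  toFun α := (α.1, α.2 + (cellScale α.1 : ℤ) • k)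
  invFun α := (α.1, α.2 - (cellScale α.1 : ℤ) • k)
  left_inv α := by simp
  right_inv α := by simp

theorem orbital_indexShift (k : Fin d → ℤ) {u u' : Space d → ℝ} {x : Space d}
    (h : u' x = u (x + latticeVec k)) (α : ℤ × (Fin d → ℤ)) :
    orbital u' α x = orbital u (indexShift k α) (x + latticeVec k) := by
  simp only [orbital, indexShift, Equiv.coe_fn_mk, cellFun_add_latticeVec, h]

theorem orbitalDeriv_indexShift (j : Fin d) (k : Fin d → ℤ) {u u' g g' : Space d → ℝ} {x : Space d}
    (h : u' x = u (x + latticeVec k)) (h' : g' x = g (x + latticeVec k)) (α : ℤ × (Fin d → ℤ)) :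
    orbitalDeriv j u' g' α x = orbitalDeriv j u g (indexShift k α) (x + latticeVec k) := by
  simp only [orbitalDeriv, indexShift, Equiv.coe_fn_mk, cellFun_add_latticeVec,
    fderiv_cellFun_add_latticeVec, h, h']

end Orbitals

/-! ### Bounds in expectation and removal of a null set -/

section Truncation

variable {Ω : Type*} [MeasurableSpace Ω] {P : Measure Ω} {d : ℕ} {A : Type*}

theorem tsum_ballMass [Countable A] {f : A → Space d → ℝ} (hf : ∀ α, Measurable (f α)) (R : ℝ) :
    ∑' α, ballMass R (f α) = ∫⁻ x in Metric.closedBall 0 R, ∑' α, ‖f α x‖ₑ ^ 2 :=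
  (lintegral_tsum fun α => ((hf α).enorm.pow_const 2).aemeasurable).symm

/-- A family which is locally square summable in expectation coincides a.s. with one which is
locally square summable everywhere. -/
theorem exists_isLocalFamily [Countable A] {f : A → Ω → Space d → ℝ}
    (hm : ∀ α, Measurable (Function.uncurry (f α)))
    (hE : ∀ R, ∫⁻ ω, ∑' α, ballMass R (f α ω) ∂P < ∞)
    (hL : ∀ ω, (∀ R, ∑' α, ballMass R (f α ω) < ∞) → ∀ α, MemLp (f α ω) 2 volume) :
    ∃ f' : A → Ω → Space d → ℝ, IsLocalFamily P f' ∧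
      (∀ ω R, ∑' α, ballMass R (f' α ω) < ∞) ∧ ∀ᵐ ω ∂P, ∀ α, f' α ω = f α ω := by
  classical
  set G : Set Ω := {ω | ∀ n : ℕ, ∑' α, ballMass (n : ℝ) (f α ω) < ∞} with hG
  have hmeas : ∀ R, Measurable fun ω => ∑' α, ballMass R (f α ω) := fun R =>
    Measurable.tsum fun α => measurable_ballMass (hm α) R
  have hGm : MeasurableSet G := by
    have : G = ⋂ n : ℕ, {ω | ∑' α, ballMass (n : ℝ) (f α ω) < ∞} := by
      ext ω
      simp [hG]
    rw [this]
    exact MeasurableSet.iInter fun n => measurableSet_lt (hmeas n) measurable_const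
  have hGR : ∀ ω ∈ G, ∀ R, ∑' α, ballMass R (f α ω) < ∞ := by
    intro ω hω R
    obtain ⟨n, hn⟩ := exists_nat_ge R
    exact lt_of_le_of_lt (ENNReal.tsum_le_tsum fun α => ballMass_mono hn _) (hω n)
  have hGae : ∀ᵐ ω ∂P, ω ∈ G :=
    ae_all_iff.2 fun n => MeasureTheory.ae_lt_top (hmeas n) (hE n).ne
  -- Setting the family to zero off the measurable almost sure event `G` lets forms and operators be
  -- defined for every `ω`.
  set f' : A → Ω → Space d → ℝ := fun α ω x => if ω ∈ G then f α ω x else 0 with hf'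
  have h1 : ∀ α, ∀ ω ∈ G, f' α ω = f α ω := fun α ω hω => by
    ext x
    simp only [hf', if_pos hω]
  have h0 : ∀ α, ∀ ω ∉ G, f' α ω = fun _ => 0 := fun α ω hω => by
    ext x
    simp only [hf', if_neg hω]
  have hae : ∀ᵐ ω ∂P, ∀ α, f' α ω = f α ω := hGae.mono fun ω hω α => h1 α ω hω
  refine ⟨f', ⟨fun α => ?_, fun α ω => ?_, fun R => ?_⟩, fun ω R => ?_, hae⟩
  · exact Measurable.ite (measurable_fst hGm) (hm α) measurable_const
  · by_cases hω : ω ∈ G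
    · rw [h1 α ω hω]
      exact hL ω (hGR ω hω) α
    · rw [h0 α ω hω]
      exact MemLp.zero
  · refine lt_of_le_of_lt (lintegral_mono_ae (hae.mono fun ω hω => ?_)) (hE R)
    simp only [hω]
    exact le_rfl
  · by_cases hω : ω ∈ G
    · simp only [h1 _ ω hω]
      exact hGR ω hω R
    · simp [h0 _ ω hω, ballMass]

theorem lintegral_closedBall_lt_top [SFinite P] {f : Ω → Space d → ℝ}
    (hm : Measurable (Function.uncurry f)) {p : ℝ≥0∞} {n : ℕ} (hn : n ≠ 0) (hp : p = n)
    (hf : MemLpLoc P p f) (R : ℝ) :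
    ∫⁻ ω, (∫⁻ x in Metric.closedBall 0 R, ‖f ω x‖ₑ ^ n) ∂P < ∞ := by
  have h1 := (hf _ (isCompact_closedBall (0 : Space d) R)).2
  rw [eLpNorm_lt_top_iff_lintegral_rpow_enorm_lt_top (by simpa [hp] using hn) (by simp [hp]), hp]
    at h1
  simp only [ENNReal.toReal_natCast, ENNReal.rpow_natCast] at h1
  rwa [lintegral_prod _ (hm.enorm.pow_const n).aemeasurable] at h1

theorem ae_memL2Loc [SFinite P] {f : Ω → Space d → ℝ} (hm : Measurable (Function.uncurry f))
    (hf : MemLpLoc P 2 f) : ∀ᵐ ω ∂P, MemL2Loc (f ω) := by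
  have h1 : ∀ᵐ ω ∂P, ∀ n : ℕ, ballMass (n : ℝ) (f ω) < ∞ := ae_all_iff.2 fun n =>
    MeasureTheory.ae_lt_top (measurable_ballMass hm _)
      (lintegral_closedBall_lt_top hm two_ne_zero (by norm_num) hf n).ne
  filter_upwards [h1] with ω hω
  have hms : AEStronglyMeasurable (f ω) := (hm.of_uncurry_left).aestronglyMeasurable
  refine ⟨hms, fun R => ?_⟩
  rw [memLp_two_iff hms Measure.restrict_le_self.absolutelyContinuous]
  obtain ⟨n, hn⟩ := exists_nat_ge R
  exact lt_of_le_of_lt (ballMass_mono hn _) (hω n)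

theorem isLocalFamily_orbital {u : Ω → Space d → ℝ} (hu : Measurable (Function.uncurry u))
    (hE : ∀ R, ∫⁻ ω, ballMass R (u ω) ∂P < ∞) :
    IsLocalFamily P fun α ω => orbital (u ω) α where
  measurable α := ((continuous_cellFun _ _).measurable.comp measurable_snd).mul
    ((continuous_level _).measurable.comp hu)
  memLp α ω := memLp_orbital hu.of_uncurry_left α
  lintegral_lt_top R := by
    have h : ∀ ω, ∑' α, ballMass R (orbital (u ω) α) = ballMass R (u ω) := fun ω => by
      have hm : ∀ α, Measurable (orbital (u ω) α) := fun α =>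
        (continuous_cellFun _ _).measurable.mul
          ((continuous_level _).measurable.comp hu.of_uncurry_left)
      rw [tsum_ballMass hm]
      simp only [tsum_enorm_orbital_sq]
      rfl
    simp only [h]
    exact hE R

/-- With `u = √ρ` the cost of the cells is `(c ρ + 3)² ρ ≤ 2 c² ρ³ + 18 ρ`: here the cube
integrability of `ρ` enters. -/
theorem lintegral_tsum_ballMass_orbitalDeriv_lt_top [SFinite P] {ρ g : Ω → Space d → ℝ}
    (hρ : Measurable (Function.uncurry ρ)) (hρ3 : MemLpLoc P 3 ρ) (hρ1 : MemLpLoc P 1 ρ)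
    (hg : Measurable (Function.uncurry g)) (hg2 : MemLpLoc P 2 g) (j : Fin d) (R : ℝ) :
    ∫⁻ ω, ∑' α, ballMass R (orbitalDeriv j (fun x => √(ρ ω x)) (g ω) α) ∂P < ∞ := by
  obtain ⟨C, hC, hCb⟩ := exists_tsum_enorm_orbitalDeriv_sq_le j
  set c : ℝ := 2 * Real.exp 4 with hc
  set K : ℝ≥0∞ := ENNReal.ofReal (2 * c ^ 2) with hK
  set K' : ℝ≥0∞ := ENNReal.ofReal 18 with hK'
  have hpt : ∀ r : ℝ, ‖(c * √r ^ 2 + 3) * √r‖ₑ ^ 2 ≤ K * ‖r‖ₑ ^ 3 + K' * ‖r‖ₑ ^ 1 := by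
    intro r
    -- An inequality valid for every real `r`, as `√r = 0` for `r ≤ 0`; no sign condition on `ρ` is
    -- needed.
    have hs : √r ^ 2 ≤ |r| := by
      rcases le_total 0 r with h | h
      · rw [Real.sq_sqrt h]
        exact le_abs_self r
      · rw [Real.sqrt_eq_zero_of_nonpos h]
        simp
    rw [enorm_sq_eq_ofReal, ← ofReal_norm, Real.norm_eq_abs, hK, hK',
      ← ENNReal.ofReal_pow (abs_nonneg _), ← ENNReal.ofReal_pow (abs_nonneg _),
      ← ENNReal.ofReal_mul (by positivity), ← ENNReal.ofReal_mul (by positivity),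
      ← ENNReal.ofReal_add (by positivity) (by positivity)]
    refine ENNReal.ofReal_le_ofReal ?_
    have hc0 : 0 ≤ c := by positivity
    calc ((c * √r ^ 2 + 3) * √r) ^ 2 = (c * √r ^ 2 + 3) ^ 2 * √r ^ 2 := by ring
      _ ≤ (c * |r| + 3) ^ 2 * |r| := by gcongr
      _ ≤ 2 * ((c * |r|) ^ 2 + 3 ^ 2) * |r| :=
          mul_le_mul_of_nonneg_right add_sq_le (abs_nonneg _)
      _ = _ := by ring
  have hbound : ∀ ω, ∑' α, ballMass R (orbitalDeriv j (fun x => √(ρ ω x)) (g ω) α)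
      ≤ C * (ballMass R (g ω) + (K * (∫⁻ x in Metric.closedBall 0 R, ‖ρ ω x‖ₑ ^ 3)
        + K' * ∫⁻ x in Metric.closedBall 0 R, ‖ρ ω x‖ₑ ^ 1)) := by
    intro ω
    have hρω : Measurable (ρ ω) := hρ.of_uncurry_left
    have hgω : Measurable (g ω) := hg.of_uncurry_left
    have hm : ∀ α, Measurable (orbitalDeriv j (fun x => √(ρ ω x)) (g ω) α) := fun α =>
      measurable_orbitalDeriv j hρω.sqrt hgω measurable_id α
    rw [tsum_ballMass hm]
    calc _ ≤ ∫⁻ x in Metric.closedBall 0 R,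
          C * (‖g ω x‖ₑ ^ 2 + (K * ‖ρ ω x‖ₑ ^ 3 + K' * ‖ρ ω x‖ₑ ^ 1)) := by
          refine lintegral_mono fun x => (hCb (fun x => √(ρ ω x)) (g ω) x).trans ?_
          gcongr
          exact hpt _
      _ = _ := by
          rw [lintegral_const_mul' _ _ hC, lintegral_add_left (hgω.enorm.pow_const 2),
            lintegral_add_left ((hρω.enorm.pow_const 3).const_mul K),
            lintegral_const_mul' _ _ ENNReal.ofReal_ne_top,
            lintegral_const_mul' _ _ ENNReal.ofReal_ne_top]
          rfl
  refine lt_of_le_of_lt (lintegral_mono hbound) ?_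
  have hm3 : Measurable fun ω => ∫⁻ x in Metric.closedBall (0 : Space d) R, ‖ρ ω x‖ₑ ^ 3 :=
    Measurable.lintegral_prod_right' (f := fun p : Ω × Space d => ‖ρ p.1 p.2‖ₑ ^ 3)
      (hρ.enorm.pow_const 3)
  rw [lintegral_const_mul' _ _ hC, lintegral_add_left (measurable_ballMass hg R),
    lintegral_add_left (hm3.const_mul K), lintegral_const_mul' _ _ ENNReal.ofReal_ne_top,
    lintegral_const_mul' _ _ ENNReal.ofReal_ne_top]
  have i2 : ∫⁻ ω, ballMass R (g ω) ∂P < ∞ :=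
    lintegral_closedBall_lt_top hg two_ne_zero (by norm_num) hg2 R
  have i3 := lintegral_closedBall_lt_top hρ three_ne_zero (by norm_num) hρ3 R
  have i1 := lintegral_closedBall_lt_top hρ one_ne_zero (by norm_num) hρ1 R
  exact ENNReal.mul_lt_top hC.lt_top (ENNReal.add_lt_top.2 ⟨i2, ENNReal.add_lt_top.2
    ⟨ENNReal.mul_lt_top ENNReal.ofReal_lt_top i3, ENNReal.mul_lt_top ENNReal.ofReal_lt_top i1⟩⟩)

end Truncation

/-! ### The operator `γ`: ergodicity, density and kinetic energy -/

section Operator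

variable {Ω : Type*} [MeasurableSpace Ω] {P : Measure Ω} {d : ℕ}
  {u : Ω → Space d → ℝ} {γ : Ω → (L2 d →L[ℂ] L2 d)}

/-- `γ(ω) = ∑ |v⟩⟨v|`, where `v` runs through the orbitals of `u(ω)`. -/
def IsOrbitalSum (hu : Measurable (Function.uncurry u)) (γ : Ω → (L2 d →L[ℂ] L2 d)) : Prop :=
  ∀ ω φ ψ, HasSum (fun α => ⟪φ, toL2 (memLp_orbital (u := u ω) hu.of_uncurry_left α)⟫_ℂ *
    ⟪toL2 (memLp_orbital (u := u ω) hu.of_uncurry_left α), ψ⟫_ℂ) ⟪φ, γ ω ψ⟫_ℂ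

theorem exists_isOrbitalSum (hd : 1 ≤ d) (hu : Measurable (Function.uncurry u)) :
    ∃ γ, IsOrbitalSum hu γ ∧ ∀ ω, 0 ≤ γ ω ∧ γ ω ≤ 1 := by
  have hex := fun ω => exists_hasSum_of_bessel
    (bessel_orbital (u := u ω) hd hu.of_uncurry_left)
  choose γ hγ0 hγ1 hγ using hex
  exact ⟨γ, hγ, fun ω => ⟨hγ0 ω, hγ1 ω⟩⟩

theorem IsOrbitalSum.isRandomOperator {hu : Measurable (Function.uncurry u)}
    (hγ : IsOrbitalSum hu γ) : IsRandomOperator γ := fun φ ψ => by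
  refine measurable_of_hasSum (fun α => ?_) fun ω => hγ ω φ ψ
  have hm : Measurable (Function.uncurry fun ω => orbital (u ω) α) :=
    ((continuous_cellFun _ _).measurable.comp measurable_snd).mul
      ((continuous_level _).measurable.comp hu)
  exact (measurable_inner_toL2 hm (fun ω => memLp_orbital hu.of_uncurry_left α) φ).mul
    (measurable_inner_toL2_left hm (fun ω => memLp_orbital hu.of_uncurry_left α) ψ)

/-- The orbitals at `k +ᵥ ω` are the translates of those at `ω` with permuted indices, and the sum
does not depend on the order. -/
theorem IsOrbitalSum.isErgodic [AddAction (Fin d → ℤ) Ω] {hu : Measurable (Function.uncurry u)}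
    (hγ : IsOrbitalSum hu γ) (hs : IsStationary P u) : IsErgodic P γ := by
  intro k
  filter_upwards [hs.stationary k] with ω hω
  refine ContinuousLinearMap.ext fun ψ => ext_inner_left ℂ fun φ => ?_
  rw [ContinuousLinearMap.comp_apply, ContinuousLinearMap.comp_apply,
    ← ContinuousLinearMap.adjoint_inner_left (translation k)]
  refine (hγ (k +ᵥ ω) φ ψ).unique ?_
  rw [← (hγ ω _ _).tsum_eq, ← (indexShift k).tsum_eq]
  have h1 : ∀ α, toL2 (memLp_orbital (u := u (k +ᵥ ω)) hu.of_uncurry_left α)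
      = translation k (toL2 (memLp_orbital (u := u ω) hu.of_uncurry_left (indexShift k α))) :=
    fun α => toL2_eq_shift _ _ (hω.mono fun x hx => orbital_indexShift k hx α)
  have h2 := (hγ (k +ᵥ ω) φ ψ)
  simp only [h1, ← ContinuousLinearMap.adjoint_inner_left (translation k),
    ← ContinuousLinearMap.adjoint_inner_right (translation k)] at h2 ⊢
  exact h2.summable.hasSum

theorem IsOrbitalSum.hasSum_localize {hu : Measurable (Function.uncurry u)}
    (hγ : IsOrbitalSum hu γ) (χ : LInf d) (ω : Ω) (φ ψ : L2 d) :
    HasSum (fun α => ⟪φ, mulOp χ (toL2 (memLp_orbital (u := u ω) hu.of_uncurry_left α))⟫_ℂ *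
      ⟪mulOp (star χ) (toL2 (memLp_orbital (u := u ω) hu.of_uncurry_left α)), ψ⟫_ℂ)
      ⟪φ, localize χ (γ ω) ψ⟫_ℂ := by
  have h := hγ ω (mulOp (star χ) φ) (mulOp χ ψ)
  simp only [← inner_mulOp_right χ φ, inner_mulOp_right χ _ ψ] at h
  exact h

theorem IsOrbitalSum.isLocallyTraceClass {hu : Measurable (Function.uncurry u)}
    (hγ : IsOrbitalSum hu γ) (hE : ∀ R, ∫⁻ ω, ballMass R (u ω) ∂P < ∞) :
    IsLocallyTraceClass P γ := fun χ hχ =>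
  (isLocalFamily_orbital hu hE).memL1TraceClass hχ fun ω φ ψ => hγ.hasSum_localize χ ω φ ψ

/-- The trace is the sum of the pairings of `χ̄ v` with `χ v`, that is of `∫ χ² v²`. Sum and
integral commute because `∑ ‖χ v‖²` is finite almost surely, and the `v²` sum to `u²`. -/
theorem IsOrbitalSum.trace_localize {hu : Measurable (Function.uncurry u)}
    (hγ : IsOrbitalSum hu γ) (hE : ∀ R, ∫⁻ ω, ballMass R (u ω) ∂P < ∞)
    {χ : LInf d} (hχ : CompactlySupported χ) :
    ∀ᵐ ω ∂P, trace (localize χ (γ ω)) = ∫ x, (χ x) ^ 2 * ((u ω x ^ 2 : ℝ) : ℂ) := by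
  obtain ⟨R, hR⟩ := hχ
  filter_upwards [(isLocalFamily_orbital hu hE).ae_lt_top] with ω hω
  set v : ℤ × (Fin d → ℤ) → L2 d :=
    fun α => toL2 (memLp_orbital (u := u ω) hu.of_uncurry_left α) with hv
  have hfin : ∑' α, (‖mulOp χ (v α)‖ₑ ^ 2 + ‖mulOp (star χ) (v α)‖ₑ ^ 2) < ∞ :=
    lt_of_le_of_lt (tsum_enorm_mulOp_sq_le hR fun α => memLp_orbital hu.of_uncurry_left α)
      (ENNReal.mul_lt_top (essSup_coeff_ne_top χ).lt_top (hω R))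
  have h1 := hasSum_trace_of_hasSum hfin fun φ ψ => hγ.hasSum_localize χ ω φ ψ
  set Φ : ℤ × (Fin d → ℤ) → Space d → ℂ :=
    fun α x => (χ x) ^ 2 * ((orbital (u ω) α x ^ 2 : ℝ) : ℂ) with hΦ
  have hv' : ∀ α, mulOp χ (v α) =ᵐ[volume] fun x => χ x * ((orbital (u ω) α x : ℝ) : ℂ) := by
    intro α
    filter_upwards [coeFn_mulOp χ (v α), coeFn_toL2 (memLp_orbital (u := u ω)
      hu.of_uncurry_left α)] with x h1 h2
    rw [h1, hv, h2]
  have hinner : ∀ α, ∀ᵐ x, ⟪mulOp (star χ) (v α) x, mulOp χ (v α) x⟫_ℂ = Φ α x := by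
    intro α
    filter_upwards [hv' α, coeFn_mulOp (star χ) (v α), coeFn_toL2 (memLp_orbital (u := u ω)
      hu.of_uncurry_left α), Lp.coeFn_star χ] with x h1 h2 h3 h4
    rw [h1, h2, h4, hv, h3, RCLike.inner_apply, Pi.star_apply, map_mul, Complex.conj_ofReal,
      RCLike.star_def, RCLike.conj_conj]
    simp only [hΦ]
    push_cast
    ring
  have hint : ∀ α, Integrable (Φ α) := fun α =>
    (L2.integrable_inner (𝕜 := ℂ) (mulOp (star χ) (v α)) (mulOp χ (v α))).congr (hinner α)
  have hnorm : ∀ α, ∫ x, ‖Φ α x‖ = ‖mulOp χ (v α)‖ ^ 2 := by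
    intro α
    rw [← integral_norm_sq]
    refine integral_congr_ae ?_
    filter_upwards [hv' α] with x hx
    rw [hx]
    simp only [hΦ, norm_mul, norm_pow, Complex.norm_real, mul_pow]
  have hsum : Summable fun α => ∫ x, ‖Φ α x‖ := by
    simp only [hnorm]
    have h2 : ∑' α, ‖mulOp χ (v α)‖ₑ ^ 2 < ∞ :=
      lt_of_le_of_lt (ENNReal.tsum_le_tsum fun α => le_self_add) hfin
    simpa using ENNReal.summable_toReal h2.ne
  have h2 := hasSum_integral_of_summable_integral_norm hint hsum
  have h3 : ∀ α, ⟪mulOp (star χ) (v α), mulOp χ (v α)⟫_ℂ = ∫ x, Φ α x := fun α => by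
    rw [L2.inner_def]
    exact integral_congr_ae (hinner α)
  simp only [h3] at h1
  rw [h1.unique h2]
  refine integral_congr_ae (.of_forall fun x => ?_)
  exact (((Complex.hasSum_ofReal.2 (hasSum_orbital_sq (u ω) x))).mul_left _).tsum_eq

/-- The form is `∑ |∂_j v⟩⟨∂_j v|`: integration by parts moves each `P_j` from the arguments onto
the orbitals, term by term. Localized, the derivatives form a summable family of rank-one operators.
-/
theorem IsOrbitalSum.exists_kineticForm [AddAction (Fin d → ℤ) Ω]
    [MeasurableConstVAdd (Fin d → ℤ) Ω] [VAddInvariantMeasure (Fin d → ℤ) Ω P]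
    {hu : Measurable (Function.uncurry u)}
    (hγ : IsOrbitalSum hu γ) (hs : IsStationary P u) {g : Ω → Space d → ℝ}
    (hg : Measurable (Function.uncurry g)) {j : Fin d}
    (hweak : ∀ᵐ ω ∂P, HasWeakDeriv j (u ω) (g ω))
    (huL : ∀ᵐ ω ∂P, MemL2Loc (u ω)) (hgL : ∀ᵐ ω ∂P, MemL2Loc (g ω))
    (hE : ∀ R, ∫⁻ ω, ∑' α, ballMass R (orbitalDeriv j (u ω) (g ω) α) ∂P < ∞) :
    ∃ B : Ω → LocalForm d,
      IsKineticForm P j γ B ∧ IsRandomForm B ∧ IsErgodicForm P B ∧ IsLocallyTraceClassForm P B := by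
  obtain ⟨D, hD, hDlt, hDae⟩ := exists_isLocalFamily (P := P)
    (f := fun α ω => orbitalDeriv j (u ω) (g ω) α)
    (fun α => measurable_orbitalDeriv j hu hg measurable_snd α) hE
    (fun ω => memLp_orbitalDeriv hu.of_uncurry_left hg.of_uncurry_left)
  set w : Ω → ℤ × (Fin d → ℤ) → L2 d := fun ω α => toL2 (hD.memLp α ω) with hw
  have hwlt : ∀ ω R, ∑' α, ballMass R (w ω α) < ∞ := fun ω R => by
    simp only [hw, ballMass_toL2]
    exact hDlt ω R
  refine ⟨fun ω => sumForm (w ω) (hwlt ω), ?_, ?_, ?_, ?_⟩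
  · filter_upwards [hweak, huL, hgL, hDae] with ω h1 h2 h3 h4 φ ψ η ζ hφ hψ
    set v : ℤ × (Fin d → ℤ) → L2 d :=
      fun α => toL2 (memLp_orbital (u := u ω) hu.of_uncurry_left α) with hv
    have hvw : ∀ α, HasWeakDeriv j (v α) (w ω α) := fun α =>
      (hasWeakDeriv_orbital h1 h2 h3 α).ofReal.congr (coeFn_toL2 _).symm
        (EventuallyEq.symm ((coeFn_toL2 (hD.memLp α ω)).trans (.of_eq (by rw [h4 α]))))
    have hmom : ∀ {φ η : L2 d}, IsMomentum j φ η → ∀ α,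
        ⟪v α, η⟫_ℂ = Complex.I * ⟪w ω α, φ⟫_ℂ := by
      intro φ η hφ α
      have hφ' : HasWeakDeriv j φ (Complex.I • η : L2 d) :=
        HasWeakDeriv.congr hφ (ae_eq_refl _) (EventuallyEq.symm (Lp.coeFn_smul Complex.I η))
      have h5 := inner_weakDeriv_eq_neg hφ' (hvw α)
      rw [inner_smul_right] at h5
      linear_combination (-Complex.I) * h5 + ⟪v α, η⟫_ℂ * Complex.I_sq
    rw [sumForm_apply, ← (hγ ω η ζ).tsum_eq]
    refine tsum_congr fun α => ?_
    have e1 := hmom hψ α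
    have e2 : ⟪η, v α⟫_ℂ = -Complex.I * ⟪(φ : L2 d), w ω α⟫_ℂ := by
      rw [← inner_conj_symm, hmom hφ α, map_mul, inner_conj_symm, Complex.conj_I]
    simp only [hv] at e1 e2
    rw [e1, e2]
    linear_combination (⟪(φ : L2 d), w ω α⟫_ℂ * ⟪w ω α, (ψ : L2 d)⟫_ℂ) * Complex.I_sq
  · intro φ ψ
    refine measurable_of_hasSum (fun α => ?_)
      fun ω => (summable_inner_mul_inner (hwlt ω) φ.2 ψ.2).hasSum
    exact (measurable_inner_toL2 (hD.measurable α) (hD.memLp α) φ).mul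
      (measurable_inner_toL2_left (hD.measurable α) (hD.memLp α) ψ)
  · intro k
    -- Invariance of `P` transports almost sure statements from `ω` to `k +ᵥ ω`.
    have hqm := (measurePreserving_vadd k P).quasiMeasurePreserving
    filter_upwards [hs.stationary k, hweak, hqm.ae hweak, hDae, hqm.ae hDae]
      with ω h1 h2 h3 h4 h5 φ ψ
    -- Both sides are weak derivatives of the same function, `u (k +ᵥ ω)`.
    have h6 : g (k +ᵥ ω) =ᵐ[volume] fun x => g ω (x + latticeVec k) :=
      (h3.congr h1 (ae_eq_refl _)).unique (h2.comp_add_right (latticeVec k))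
    have h7 : ∀ α, w (k +ᵥ ω) α = translation k (w ω (indexShift k α)) := fun α => by
      refine toL2_eq_shift _ _ ?_
      filter_upwards [h1, h6] with x hx hx'
      rw [h5, h4]
      exact orbitalDeriv_indexShift j k hx hx' α
    simp only [sumForm_apply, h7]
    rw [← (indexShift k).tsum_eq fun α => ⟪(φ : L2 d), w ω α⟫_ℂ * ⟪w ω α, (ψ : L2 d)⟫_ℂ]
    refine tsum_congr fun α => ?_
    simp only [translation_apply, LinearIsometry.inner_map_map]
  · intro χ hχ
    obtain ⟨R, hR⟩ := id hχ
    have hex : ∀ ω, ∃ T : L2 d →L[ℂ] L2 d, ∀ φ ψ, HasSum (fun α => ⟪φ, mulOp χ (w ω α)⟫_ℂ *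
        ⟪mulOp (star χ) (w ω α), ψ⟫_ℂ) ⟪φ, T ψ⟫_ℂ := fun ω =>
      exists_hasSum_of_tsum_lt_top (lt_of_le_of_lt (tsum_enorm_mulOp_sq_le hR fun α =>
        hD.memLp α ω) (ENNReal.mul_lt_top (essSup_coeff_ne_top χ).lt_top (hDlt ω R)))
    choose T hT using hex
    refine ⟨T, hD.memL1TraceClass hχ hT, .of_forall fun ω φ ψ => ?_⟩
    rw [sumForm_apply, ← (hT ω φ ψ).tsum_eq]
    refine tsum_congr fun α => ?_
    rw [inner_mulOp_right χ φ, ← inner_mulOp_right χ _ ψ]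

end Operator

end ErgodicRepr

/-! ### The representability theorem -/

theorem theorem2p11 {Ω : Type*} [MeasurableSpace Ω] (P : Measure Ω) [IsProbabilityMeasure P]
    (d : ℕ) (hd : 1 ≤ d)
    [AddAction (Fin d → ℤ) Ω] [MeasurableConstVAdd (Fin d → ℤ) Ω] [ErgodicVAdd (Fin d → ℤ) Ω P]
    (ρ : Ω → ErgodicRepr.Space d → ℝ)
    (hρ_nonneg : ∀ᵐ ω ∂P, ∀ᵐ x, 0 ≤ ρ ω x)
    (hρ : ErgodicRepr.MemLps P 3 ρ)
    (hρ_sqrt : ErgodicRepr.MemH1s P fun ω x => Real.sqrt (ρ ω x)) :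
    ∃ γ : Ω → (ErgodicRepr.L2 d →L[ℂ] ErgodicRepr.L2 d),
      ErgodicRepr.IsRandomOperator γ ∧
      ErgodicRepr.IsErgodic P γ ∧
      (∀ᵐ ω ∂P, IsSelfAdjoint (γ ω)) ∧
      (∀ᵐ ω ∂P, 0 ≤ γ ω ∧ γ ω ≤ 1) ∧
      ErgodicRepr.IsLocallyTraceClass P γ ∧
      ErgodicRepr.HasLocallyFiniteKineticEnergy P γ ∧
      ErgodicRepr.IsDensity P γ ρ := by
  have hs := hρ_sqrt.memLps.isStationary
  have hu := hs.measurable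
  have hu2 := hρ_sqrt.memLps.memLpLoc
  have hρm := hρ.isStationary.measurable
  have hE : ∀ R, ∫⁻ ω, ErgodicRepr.ballMass R (fun x => √(ρ ω x)) ∂P < ∞ := fun R =>
    ErgodicRepr.lintegral_closedBall_lt_top hu two_ne_zero (by norm_num) hu2 R
  -- The product of `P` with Lebesgue measure on a compact set is finite, so `L³` is contained in
  -- `L¹` there.
  have hρ1 : ErgodicRepr.MemLpLoc P 1 ρ := fun K hK => by
    have : IsFiniteMeasure ((volume : Measure (ErgodicRepr.Space d)).restrict K) :=
      ⟨by simpa using hK.measure_lt_top⟩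
    exact (hρ.memLpLoc K hK).mono_exponent (by norm_num)
  obtain ⟨γ, hγ, hγ01⟩ := ErgodicRepr.exists_isOrbitalSum hd hu
  refine ⟨γ, hγ.isRandomOperator, hγ.isErgodic hs,
    .of_forall fun ω => IsSelfAdjoint.of_nonneg (hγ01 ω).1,
    .of_forall hγ01, hγ.isLocallyTraceClass hE, fun j => ?_,
    ⟨hρ.isStationary, hρ1⟩, fun χ hχ => ?_⟩
  · obtain ⟨g, hg, hg2, hweak⟩ := hρ_sqrt.exists_grad j
    exact hγ.exists_kineticForm hs hg hweak (ErgodicRepr.ae_memL2Loc hu hu2)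
      (ErgodicRepr.ae_memL2Loc hg hg2) fun R =>
      ErgodicRepr.lintegral_tsum_ballMass_orbitalDeriv_lt_top hρm hρ.memLpLoc hρ1 hg hg2 j R
  · filter_upwards [hγ.trace_localize hE hχ, hρ_nonneg] with ω h1 h2
    rw [h1]
    refine integral_congr_ae (h2.mono fun x hx => ?_)
    simp only [Real.sq_sqrt hx]
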